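/- Conventions. Rings are associative with $1$, subrings share the unit, and a subring $B\subseteq A$ is called a division ring if $B\neq 0$ and every nonzero element of $B$ is invertible in $B$. For subrings $C\subseteq B\subseteq A$, the tower $A\supseteq B\supseteq C$ is *left depth three* (left D3) if $A\otimes_B A$ is isomorphic, as a $C$-$A$-bimodule, to a direct summand of $A^N$ for some $N$; the extension $A\supseteq C$ is *depth two* (D2) if $A\otimes_C A$ is isomorphic to a direct summand of some $A^N$ both as a $C$-$A$-bimodule and as an $A$-$C$-bimodule. Write $\operatorname{End}{}_CA_B$ for the ring (under composition) of $C$-$B$-bimodule endomorphisms of $A$. Let $A\supseteq C$ be a D2 extension, with centralizer $V=A^C=\{v\in A: vc=cv\ \forall c\in C\}$. Then $S=\operatorname{End}{}_CA_C$ is a left bialgebroid over $V$: its $V$-bimodule structure is $v\cdot\alpha\cdot v'=v\,\alpha(-)\,v'$, and its coproduct $\Delta:S\to S\otimes_V S$ sends $\alpha$ to the unique element $\sum\alpha_{(1)}\otimes\alpha_{(2)}$ with $\alpha(aa')=\sum\alpha_{(1)}(a)\,\alpha_{(2)}(a')$ for all $a,a'\in A$. A *left coideal subring* of $S$ is a subring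 $\mathcal J\subseteq S$ with $V\cdot\mathcal J\subseteq\mathcal J$ such that $\Delta(\mathcal J)$ is contained in the image of $S\otimes_V\mathcal J$ in $S\otimes_VS$. It is called *Galois* if (1) ${}_V\mathcal J$ is finitely generated projective, and (2) $0$ and $A$ are the only left ideals $I$ of $A$ with $\alpha(I)\subseteq I$ for all $\alpha\in\mathcal J$. Put $A^{\mathcal J}=\{x\in A:\alpha(x)=\alpha(1)x\ \forall\alpha\in\mathcal J\}$. **Theorem 6.3.** Let $A\supseteq C$ be a D2 extension, where $C$ is a division ring and $A$ is an augmented ring, i.e. there is a ring homomorphism from $A$ to a division ring. Let $V=A^C$ and let $S=\operatorname{End}{}_CA_C$ be the left $V$-bialgebroid above. Suppose that the right $V$-module $A_V$ is faithfully flat. Then $B\mapsto\operatorname{End}{}_CA_B$ is an inclusion-reversing bijection, whose inverse is also inclusion-reversing, from the set of division rings $B$ with $C\subseteq B\subseteq A$ such that $A\supseteq B\supseteq C$ is left D3 onto the set of Galois left coideal subrings of $S$; the inverse is $\mathcal J\mapsto A^{\mathcal J}$. -/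

import Mathlib

universe u v w

open scoped TensorProduct

namespace DepthThree

/-! ## Tensor products over a noncommutative ring -/

section BalTensor

variable (R : Type u) [Ring R] (M : Type v) [AddCommGroup M] [Module Rᵐᵒᵖ M]
  (N : Type w) [AddCommGroup N] [Module R N]

/-- The subgroup of `M ⊗[ℤ] N` generated by the elements `m r ⊗ n - m ⊗ r n`. -/
def balRel : AddSubgroup (M ⊗[ℤ] N) :=
  AddSubgroup.closure
    {x | ∃ (m : M) (r : R) (n : N), x = (MulOpposite.op r • m) ⊗ₜ[ℤ] n - m ⊗ₜ[ℤ] (r • n)}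

/-- The tensor product `M ⊗_R N` of a right `R`-module `M` and a left `R`-module `N` over a
not necessarily commutative ring `R`, as an abelian group. -/
def BalTensor : Type (max v w) := (M ⊗[ℤ] N) ⧸ balRel R M N

instance : AddCommGroup (BalTensor R M N) :=
  inferInstanceAs (AddCommGroup ((M ⊗[ℤ] N) ⧸ balRel R M N))

variable {M N}

/-- The pure tensor `m ⊗ n` in `M ⊗_R N`. -/
def btmul (m : M) (n : N) : BalTensor R M N := QuotientAddGroup.mk (m ⊗ₜ[ℤ] n)

theorem btmul_add_left (m m' : M) (n : N) :
    btmul R (m + m') n = btmul R m n + btmul R m' n :=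
  congrArg (QuotientAddGroup.mk (s := balRel R M N)) (TensorProduct.add_tmul m m' n)

theorem btmul_add_right (m : M) (n n' : N) :
    btmul R m (n + n') = btmul R m n + btmul R m n' :=
  congrArg (QuotientAddGroup.mk (s := balRel R M N)) (TensorProduct.tmul_add m n n')

theorem btmul_smul (m : M) (r : R) (n : N) :
    btmul R (MulOpposite.op r • m) n = btmul R m (r • n) := by
  refine (QuotientAddGroup.eq_iff_sub_mem (N := balRel R M N)).2 ?_
  exact AddSubgroup.subset_closure ⟨m, r, n, rfl⟩

theorem btmul_zero_left (n : N) : btmul R (0 : M) n = 0 := by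
  have := btmul_add_left R (0 : M) 0 n
  simpa using this

theorem btmul_zero_right (m : M) : btmul R m (0 : N) = 0 := by
  have := btmul_add_right R m (0 : N) 0
  simpa using this

variable {R} in
theorem BalTensor.induction {p : BalTensor R M N → Prop} (t : BalTensor R M N)
    (h0 : p 0) (hmul : ∀ m n, p (btmul R m n)) (hadd : ∀ x y, p x → p y → p (x + y)) : p t := by
  induction t using QuotientAddGroup.induction_on with
  | H z =>
    induction z using TensorProduct.induction_on with
    | zero => exact h0
    | tmul m n => exact hmul m n
    | add x y hx hy => exact hadd _ _ hx hy

variable {R} in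
/-- The universal property: a biadditive map with `f (m r) n = f m (r n)` factors through
`M ⊗_R N`. -/
def BalTensor.lift {P : Type*} [AddCommGroup P] (f : M →+ N →+ P)
    (hf : ∀ m (r : R) n, f (MulOpposite.op r • m) n = f m (r • n)) : BalTensor R M N →+ P :=
  QuotientAddGroup.lift (balRel R M N)
    (TensorProduct.liftAddHom f fun z m n => by simp)
    (by
      unfold balRel
      rw [AddSubgroup.closure_le]
      rintro _ ⟨m, r, n, rfl⟩
      simp [hf])

variable {R} in
@[simp] theorem BalTensor.lift_btmul {P : Type*} [AddCommGroup P] (f : M →+ N →+ P)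
    (hf : ∀ m (r : R) n, f (MulOpposite.op r • m) n = f m (r • n)) (m : M) (n : N) :
    BalTensor.lift f hf (btmul R m n) = f m n := rfl

variable {R} in
theorem BalTensor.hom_ext {P : Type*} [AddCommGroup P] {f g : BalTensor R M N →+ P}
    (h : ∀ m n, f (btmul R m n) = g (btmul R m n)) (t : BalTensor R M N) : f t = g t := by
  induction t using BalTensor.induction with
  | h0 => simp
  | hmul m n => exact h m n
  | hadd x y hx hy => simp [hx, hy]

variable {R} in
/-- The map `id ⊗ f : M ⊗_R N → M ⊗_R N'`. -/
def BalTensor.lTensor (M : Type v) [AddCommGroup M] [Module Rᵐᵒᵖ M] {N' : Type*}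
    [AddCommGroup N'] [Module R N'] (f : N →ₗ[R] N') : BalTensor R M N →+ BalTensor R M N' :=
  BalTensor.lift
    (AddMonoidHom.mk' (fun m => AddMonoidHom.mk' (fun n => btmul R m (f n))
        fun n n' => by rw [map_add, btmul_add_right])
      fun m m' => by ext n; exact btmul_add_left R m m' (f n))
    fun m r n => by
      change btmul R (MulOpposite.op r • m) (f n) = btmul R m (f (r • n))
      rw [map_smul, btmul_smul]

end BalTensor

/-- A right `R`-module `M` is faithfully flat: `M ⊗_R -` preserves injectivity of maps of left
`R`-modules (flatness), and it kills no nonzero left `R`-module. -/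
structure IsFaithfullyFlat (R : Type u) [Ring R] (M : Type v) [AddCommGroup M]
    [Module Rᵐᵒᵖ M] : Prop where
  flat : ∀ (N N' : Type u) [AddCommGroup N] [AddCommGroup N'] [Module R N] [Module R N']
    (f : N →ₗ[R] N'), Function.Injective f → Function.Injective (BalTensor.lTensor M f)
  faithful : ∀ (N : Type u) [AddCommGroup N] [Module R N],
    Subsingleton (BalTensor R M N) → Subsingleton N

/-! ## Towers of rings -/

section Towers

variable {A : Type u} [Ring A]

/-- The subring `B` of `A` is a division ring. -/
def IsDivisionSubring (B : Subring A) : Prop :=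
  Nontrivial B ∧ ∀ b : B, b ≠ 0 → IsUnit b

/-- `A` as a right module over a subring `B`. -/
instance instRightModule (B : Subring A) : Module (↥B)ᵐᵒᵖ A :=
  Module.compHom A (RingHom.op B.subtype)

theorem op_smul_eq (B : Subring A) (b : B) (a : A) : MulOpposite.op b • a = a * (b : A) := rfl

/-- The tensor square `A ⊗_B A`. -/
abbrev TensorSquare (B : Subring A) : Type u := BalTensor (↥B) A A

/-- The `A`-`A`-bimodule structure of `A ⊗_B A`: the map `t ↦ a t a'`, which is
`x ⊗ y ↦ a x ⊗ y a'` on pure tensors. -/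
def biAct (B : Subring A) (a a' : A) : TensorSquare B →+ TensorSquare B :=
  BalTensor.lift
    (AddMonoidHom.mk' (fun x => AddMonoidHom.mk' (fun y => btmul (↥B) (a * x) (y * a'))
        fun y y' => by rw [add_mul, btmul_add_right])
      fun x x' => by
        ext y
        change btmul (↥B) (a * (x + x')) (y * a') = btmul _ _ _ + btmul _ _ _
        rw [mul_add, btmul_add_left])
    fun x b y => by
      change btmul (↥B) (a * (x * b)) (y * a') = btmul (↥B) (a * x) (((b : A) * y) * a')
      have := btmul_smul (↥B) (a * x) b (y * a')
      rw [op_smul_eq, Subring.smul_def, smul_eq_mul] at this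
      rw [← mul_assoc, this, mul_assoc]

@[simp] theorem biAct_btmul (B : Subring A) (a a' x y : A) :
    biAct B a a' (btmul (↥B) x y) = btmul (↥B) (a * x) (y * a') := rfl

/-- `A ⊗_B A` is isomorphic, as an `L`-`R`-bimodule, to a direct summand of `A ⊕ ⋯ ⊕ A`
(finitely many copies): there are `L`-`R`-bimodule maps `f : A ⊗_B A → Aⁿ` and
`g : Aⁿ → A ⊗_B A` with `g ∘ f = id`. -/
def TensorSquareIsSummand (B L R : Subring A) : Prop :=
  ∃ (n : ℕ) (f : TensorSquare B →+ (Fin n → A)) (g : (Fin n → A) →+ TensorSquare B),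
    (∀ l ∈ L, ∀ r ∈ R, ∀ t i, f (biAct B l r t) i = l * f t i * r) ∧
    (∀ l ∈ L, ∀ r ∈ R, ∀ z : Fin n → A, g (fun i => l * z i * r) = biAct B l r (g z)) ∧
    ∀ t, g (f t) = t

/-- The tower `A ⊇ B ⊇ C` is left depth three: `A ⊗_B A` is a `C`-`A`-bimodule direct summand of
some `Aⁿ`. -/
def IsLeftD3 (C B : Subring A) : Prop := TensorSquareIsSummand B C ⊤

/-- The extension `A ⊇ C` is left depth two: `A ⊗_C A` is a `C`-`A`-bimodule direct summand of
some `Aⁿ`. -/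
def IsLeftD2 (C : Subring A) : Prop := TensorSquareIsSummand C C ⊤

/-- The extension `A ⊇ C` is right depth two: `A ⊗_C A` is an `A`-`C`-bimodule direct summand of
some `Aⁿ`. -/
def IsRightD2 (C : Subring A) : Prop := TensorSquareIsSummand C ⊤ C

/-- The extension `A ⊇ C` is depth two. -/
def IsD2 (C : Subring A) : Prop := IsLeftD2 C ∧ IsRightD2 C

/-- The centralizer `V = A^C` of `C` in `A`. -/
abbrev centr (C : Subring A) : Subring A := Subring.centralizer (C : Set A)

/-- The ring `End _C A_B` of `C`-`B`-bimodule endomorphisms of `A`, as a subring of the ring of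
additive endomorphisms of `A` (the product is composition). -/
def bimoduleEnd (C B : Subring A) : Subring (AddMonoid.End A) where
  carrier := {α | (∀ c ∈ C, ∀ a, α (c * a) = c * α a) ∧ ∀ b ∈ B, ∀ a, α (a * b) = α a * b}
  mul_mem' {α β} hα hβ := by
    refine ⟨fun c hc a => ?_, fun b hb a => ?_⟩
    · change α (β (c * a)) = c * α (β a)
      rw [hβ.1 c hc, hα.1 c hc]
    · change α (β (a * b)) = α (β a) * b
      rw [hβ.2 b hb, hα.2 b hb]
  one_mem' := ⟨fun _ _ _ => rfl, fun _ _ _ => rfl⟩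
  add_mem' {α β} hα hβ := by
    refine ⟨fun c hc a => ?_, fun b hb a => ?_⟩
    · change α (c * a) + β (c * a) = c * (α a + β a)
      rw [hβ.1 c hc, hα.1 c hc, mul_add]
    · change α (a * b) + β (a * b) = (α a + β a) * b
      rw [hβ.2 b hb, hα.2 b hb, add_mul]
  zero_mem' := ⟨fun c _ _ => (mul_zero c).symm, fun b _ _ => (zero_mul b).symm⟩
  neg_mem' {α} hα := by
    refine ⟨fun c hc a => ?_, fun b hb a => ?_⟩
    · change -α (c * a) = c * -α a
      rw [hα.1 c hc, mul_neg]
    · change -α (a * b) = -α a * b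
      rw [hα.2 b hb, neg_mul]

/-- `S = End _C A_C`, the total ring of the left bialgebroid over `V = A^C`. -/
abbrev bialgS (C : Subring A) : Subring (AddMonoid.End A) := bimoduleEnd C C

variable {C : Subring A}

theorem bialgS_ext {α β : bialgS C} (h : ∀ a, α.1 a = β.1 a) : α = β :=
  Subtype.ext (AddMonoidHom.ext h)

theorem sum_val_apply {ι : Type*} (s : Finset ι) (f : ι → bialgS C) (a : A) :
    (∑ j ∈ s, f j).1 a = ∑ j ∈ s, (f j).1 a :=
  map_sum (AddMonoidHom.mk' (fun α : bialgS C => α.1 a) fun _ _ => rfl) f s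

/-- `v · α = v α(-)`, composition of `α` with left multiplication by `v` (the image of `v` under
the source map of the bialgebroid). -/
instance instSMulLeft : SMul (centr C) (bialgS C) where
  smul v α := ⟨(AddMonoidHom.mulLeft (v : A)).comp α.1, by
    refine ⟨fun c hc a => ?_, fun c hc a => ?_⟩
    · change (v : A) * α.1 (c * a) = c * ((v : A) * α.1 a)
      rw [α.2.1 c hc, ← mul_assoc, ← mul_assoc, (Subring.mem_centralizer_iff.1 v.2) c hc]
    · change (v : A) * α.1 (a * c) = (v : A) * α.1 a * c
      rw [α.2.2 c hc, mul_assoc]⟩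

theorem smul_val_apply (v : centr C) (α : bialgS C) (a : A) :
    (v • α).1 a = (v : A) * α.1 a := rfl

/-- `S` as a left `V`-module. -/
instance instModuleLeft : Module (centr C) (bialgS C) where
  one_smul α := bialgS_ext fun a => one_mul (α.1 a)
  mul_smul v w α := bialgS_ext fun a => mul_assoc (v : A) (w : A) (α.1 a)
  smul_zero v := bialgS_ext fun _ => mul_zero (v : A)
  smul_add v α β := bialgS_ext fun a => mul_add (v : A) (α.1 a) (β.1 a)
  add_smul v w α := bialgS_ext fun a => add_mul (v : A) (w : A) (α.1 a)
  zero_smul α := bialgS_ext fun a => zero_mul (α.1 a)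

/-- `α · v = α(-) v`, composition of `α` with right multiplication by `v` (the image of `v` under
the target map of the bialgebroid). -/
instance instSMulRight : SMul (centr C)ᵐᵒᵖ (bialgS C) where
  smul v α := ⟨(AddMonoidHom.mulRight (v.unop : A)).comp α.1, by
    refine ⟨fun c hc a => ?_, fun c hc a => ?_⟩
    · change α.1 (c * a) * (v.unop : A) = c * (α.1 a * (v.unop : A))
      rw [α.2.1 c hc, mul_assoc]
    · change α.1 (a * c) * (v.unop : A) = α.1 a * (v.unop : A) * c
      rw [α.2.2 c hc, mul_assoc, mul_assoc, (Subring.mem_centralizer_iff.1 v.unop.2) c hc]⟩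

theorem op_smul_val_apply (v : centr C) (α : bialgS C) (a : A) :
    (MulOpposite.op v • α).1 a = α.1 a * (v : A) := rfl

/-- `S` as a right `V`-module. -/
instance instModuleRight : Module (centr C)ᵐᵒᵖ (bialgS C) where
  one_smul α := bialgS_ext fun a => mul_one (α.1 a)
  mul_smul v w α := bialgS_ext fun a => (mul_assoc (α.1 a) (w.unop : A) (v.unop : A)).symm
  smul_zero v := bialgS_ext fun _ => zero_mul (v.unop : A)
  smul_add v α β := bialgS_ext fun a => add_mul (α.1 a) (β.1 a) (v.unop : A)
  add_smul v w α := bialgS_ext fun a => mul_add (α.1 a) (v.unop : A) (w.unop : A)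
  zero_smul α := bialgS_ext fun a => mul_zero (α.1 a)

/-- `S ⊗_V S`. -/
abbrev SS (C : Subring A) : Type u := BalTensor (centr C) (bialgS C) (bialgS C)

/-- The pairing of `d = ∑ α ⊗ β ∈ S ⊗_V S` with `a, a' ∈ A`: `∑ α(a) β(a')`. -/
def evalPair (C : Subring A) (a a' : A) : SS C →+ A :=
  BalTensor.lift
    (AddMonoidHom.mk' (fun α => AddMonoidHom.mk' (fun β => α.1 a * β.1 a')
        fun β β' => mul_add _ _ _)
      fun α α' => by ext β; exact add_mul _ _ _)
    fun α v β => mul_assoc (α.1 a) (v : A) (β.1 a')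

@[simp] theorem evalPair_btmul (a a' : A) (α β : bialgS C) :
    evalPair C a a' (btmul (centr C) α β) = α.1 a * β.1 a' := rfl

/-! ### The coproduct of `S` -/

/-- For a right `C`-linear `α`, the map `A ⊗_C A → A`, `x ⊗ y ↦ α(a x) y`. -/
def contr (α : bialgS C) (a : A) : TensorSquare C →+ A :=
  BalTensor.lift
    (AddMonoidHom.mk' (fun x => AddMonoidHom.mk' (fun y => α.1 (a * x) * y)
        fun y y' => mul_add _ _ _)
      fun x x' => by
        ext y
        change α.1 (a * (x + x')) * y = α.1 (a * x) * y + α.1 (a * x') * y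
        rw [mul_add, map_add, add_mul])
    fun x c y => by
      change α.1 (a * (x * c)) * y = α.1 (a * x) * ((c : A) * y)
      rw [← mul_assoc, α.2.2 c c.2, mul_assoc]

@[simp] theorem contr_btmul (α : bialgS C) (a x y : A) :
    contr α a (btmul (↥C) x y) = α.1 (a * x) * y := rfl

/-- `t ∈ (A ⊗_C A)^C`. -/
def IsCentral (t : TensorSquare C) : Prop := ∀ c ∈ C, biAct C c 1 t = biAct C 1 c t

theorem contr_biAct_left (α : bialgS C) (a x : A) (t : TensorSquare C) :
    contr α a (biAct C x 1 t) = contr α (a * x) t := by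
  refine BalTensor.hom_ext (f := (contr α a).comp (biAct C x 1)) (g := contr α (a * x)) ?_ t
  intro m n
  simp [mul_assoc]

theorem contr_biAct_right (α : bialgS C) (a y : A) (t : TensorSquare C) :
    contr α a (biAct C 1 y t) = contr α a t * y := by
  refine BalTensor.hom_ext (f := (contr α a).comp (biAct C 1 y))
    (g := (AddMonoidHom.mulRight y).comp (contr α a)) ?_ t
  intro m n
  simp [mul_assoc]

theorem contr_mul_left (α : bialgS C) {c : A} (hc : c ∈ C) (a : A) (t : TensorSquare C) :
    contr α (c * a) t = c * contr α a t := by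
  refine BalTensor.hom_ext (f := contr α (c * a))
    (g := (AddMonoidHom.mulLeft c).comp (contr α a)) ?_ t
  intro m n
  simp [mul_assoc, α.2.1 c hc]

theorem contr_add (α : bialgS C) (a a' : A) (t : TensorSquare C) :
    contr α (a + a') t = contr α a t + contr α a' t := by
  refine BalTensor.hom_ext (f := contr α (a + a')) (g := contr α a + contr α a') ?_ t
  intro m n
  simp [add_mul]

/-- For `t = ∑ t¹ ⊗ t² ∈ (A ⊗_C A)^C` and `α ∈ S`, the element `∑ α(- t¹) t²` of `S`. -/
def leg (α : bialgS C) (t : TensorSquare C) (ht : IsCentral t) : bialgS C :=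
  ⟨AddMonoidHom.mk' (fun a => contr α a t) fun a a' => contr_add α a a' t, by
    refine ⟨fun c hc a => contr_mul_left α hc a t, fun c hc a => ?_⟩
    change contr α (a * c) t = contr α a t * c
    rw [← contr_biAct_left, ht c hc, contr_biAct_right]⟩

/-- Left D2 quasibases of `A ⊇ C`: elements `β_j ∈ S` and `t_j ∈ (A ⊗_C A)^C` with
`x ⊗ y = ∑_j t_j β_j(x) y` for all `x, y ∈ A`. -/
structure LeftQuasibases (C : Subring A) where
  n : ℕ
  β : Fin n → bialgS C
  t : Fin n → TensorSquare C
  central : ∀ j, IsCentral (t j)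
  eq : ∀ x y : A, btmul (↥C) x y = ∑ j, biAct C 1 ((β j).1 x * y) (t j)

theorem exists_quasibases (h : IsLeftD2 C) : Nonempty (LeftQuasibases C) := by
  obtain ⟨n, f, g, hf, hg, hgf⟩ := h
  have hf1 : ∀ r : A, ∀ t i, f (biAct C 1 r t) i = f t i * r := fun r t i => by
    rw [hf 1 C.one_mem r trivial, one_mul]
  refine ⟨⟨n, fun j => ⟨AddMonoidHom.mk' (fun x => f (btmul (↥C) x 1) j) ?_, ?_, ?_⟩,
    fun j => g (Pi.single j 1), ?_, ?_⟩⟩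
  · intro x x'
    rw [btmul_add_left, map_add, Pi.add_apply]
  · intro c hc a
    change f (btmul (↥C) (c * a) 1) j = c * f (btmul (↥C) a 1) j
    have := hf c hc 1 trivial (btmul (↥C) a 1) j
    simpa using this
  · intro c hc a
    change f (btmul (↥C) (a * c) 1) j = f (btmul (↥C) a 1) j * c
    have h1 := btmul_smul (↥C) a ⟨c, hc⟩ (1 : A)
    rw [op_smul_eq, Subring.smul_def, smul_eq_mul] at h1
    have h2 := hf1 c (btmul (↥C) a 1) j
    rw [biAct_btmul, one_mul, one_mul] at h2
    rw [← h2]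
    simpa using congrArg (fun z => f z j) h1
  · intro j c hc
    rw [← hg c hc 1 trivial, ← hg 1 C.one_mem c trivial]
    congr 1
    funext i
    by_cases hij : i = j
    · subst hij; simp
    · simp [Pi.single_eq_of_ne hij]
  · intro x y
    have h1 : btmul (↥C) x y = g (f (btmul (↥C) x y)) := (hgf _).symm
    rw [h1]
    have h2 : f (btmul (↥C) x y) =
        ∑ j, fun i => (1 : A) * (Pi.single j (1 : A) : Fin n → A) i *
          (f (btmul (↥C) x 1) j * y) := by
      funext i
      rw [Finset.sum_apply, Finset.sum_eq_single i]
      · have := hf1 y (btmul (↥C) x 1) i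
        simpa using this
      · intro j _ hj
        simp [Pi.single_eq_of_ne hj.symm]
      · simp
    rw [h2, map_sum]
    refine Finset.sum_congr rfl fun j _ => ?_
    rw [hg 1 C.one_mem _ trivial]
    rfl

theorem contr_one_mem (α : bialgS C) {t : TensorSquare C} (ht : IsCentral t) :
    contr α 1 t ∈ centr C := by
  rw [Subring.mem_centralizer_iff]
  intro c hc
  rw [← contr_mul_left α hc, mul_one]
  have := contr_biAct_left α 1 c t
  rw [one_mul] at this
  rw [← this, ht c hc, contr_biAct_right]

/-- The coefficient `∑ α(t_j¹) t_j² ∈ V`. -/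
def LeftQuasibases.coeff (q : LeftQuasibases C) (α : bialgS C) (j : Fin q.n) : centr C :=
  ⟨contr α 1 (q.t j), contr_one_mem α (q.central j)⟩

theorem LeftQuasibases.contr_eq (q : LeftQuasibases C) (α : bialgS C) (a x : A) :
    α.1 (a * x) = ∑ j, contr α a (q.t j) * (q.β j).1 x := by
  have h := congrArg (contr α a) (q.eq x 1)
  rw [map_sum] at h
  simpa [contr_biAct_right] using h

theorem LeftQuasibases.expand (q : LeftQuasibases C) (α : bialgS C) :
    α = ∑ j, q.coeff α j • q.β j := by
  refine bialgS_ext fun x => ?_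
  have h := q.contr_eq α 1 x
  rw [one_mul] at h
  rw [h, sum_val_apply]
  rfl

theorem btmul_sum_right {ι : Type*} (s : Finset ι) (α : bialgS C) (f : ι → bialgS C) :
    btmul (centr C) α (∑ j ∈ s, f j) = ∑ j ∈ s, btmul (centr C) α (f j) :=
  map_sum (AddMonoidHom.mk' (fun β => btmul (centr C) α β) (btmul_add_right _ α)) f s

theorem btmul_sum_left {ι : Type*} (s : Finset ι) (f : ι → bialgS C) (β : bialgS C) :
    btmul (centr C) (∑ j ∈ s, f j) β = ∑ j ∈ s, btmul (centr C) (f j) β :=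
  map_sum (AddMonoidHom.mk' (fun α => btmul (centr C) α β)
    fun α α' => btmul_add_left _ α α' β) f s

theorem LeftQuasibases.exists_rep (q : LeftQuasibases C) (d : SS C) :
    ∃ σ : Fin q.n → bialgS C, d = ∑ j, btmul (centr C) (σ j) (q.β j) := by
  induction d using BalTensor.induction with
  | h0 => exact ⟨0, by simp [btmul_zero_left]⟩
  | hmul α γ =>
    refine ⟨fun j => MulOpposite.op (q.coeff γ j) • α, ?_⟩
    conv_lhs => rw [q.expand γ]
    rw [btmul_sum_right]
    exact Finset.sum_congr rfl fun j _ => (btmul_smul _ _ _ _).symm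
  | hadd x y hx hy =>
    obtain ⟨σ, rfl⟩ := hx
    obtain ⟨τ, rfl⟩ := hy
    refine ⟨σ + τ, ?_⟩
    rw [← Finset.sum_add_distrib]
    exact Finset.sum_congr rfl fun j _ => (btmul_add_left _ _ _ _).symm

theorem LeftQuasibases.eq_zero (q : LeftQuasibases C) (d : SS C)
    (hd : ∀ a a', evalPair C a a' d = 0) : d = 0 := by
  obtain ⟨σ, rfl⟩ := q.exists_rep d
  have key : ∀ i, ∑ j, MulOpposite.op (q.coeff (q.β j) i) • σ j = 0 := by
    intro i
    refine bialgS_ext fun a => ?_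
    rw [sum_val_apply]
    change ∑ j, (σ j).1 a * contr (q.β j) 1 (q.t i) = 0
    have h := BalTensor.hom_ext
      (f := ∑ j, (AddMonoidHom.mulLeft ((σ j).1 a)).comp (contr (q.β j) 1))
      (g := (0 : TensorSquare C →+ A)) (fun x y => by
        have h1 := hd a x
        rw [map_sum] at h1
        simp only [evalPair_btmul] at h1
        rw [AddMonoidHom.finsetSum_apply]
        simp only [AddMonoidHom.comp_apply, contr_btmul, one_mul, AddMonoidHom.coe_mulLeft,
          AddMonoidHom.zero_apply]
        simp only [← mul_assoc]
        rw [← Finset.sum_mul, h1, zero_mul]) (q.t i)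
    rw [AddMonoidHom.finsetSum_apply] at h
    exact h
  calc ∑ j, btmul (centr C) (σ j) (q.β j)
      = ∑ j, ∑ i, btmul (centr C) (MulOpposite.op (q.coeff (q.β j) i) • σ j) (q.β i) := by
        refine Finset.sum_congr rfl fun j _ => ?_
        conv_lhs => rw [q.expand (q.β j)]
        rw [btmul_sum_right]
        exact Finset.sum_congr rfl fun i _ => (btmul_smul _ _ _ _).symm
    _ = ∑ i, btmul (centr C) (∑ j, MulOpposite.op (q.coeff (q.β j) i) • σ j) (q.β i) := by
        rw [Finset.sum_comm]
        exact Finset.sum_congr rfl fun i _ => (btmul_sum_left _ _ _).symm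
    _ = 0 := by simp [key, btmul_zero_left]

theorem LeftQuasibases.evalPair_eq (q : LeftQuasibases C) (α : bialgS C) (a a' : A) :
    evalPair C a a' (∑ j, btmul (centr C) (leg α (q.t j) (q.central j)) (q.β j))
      = α.1 (a * a') := by
  rw [map_sum, q.contr_eq α a a']
  rfl

theorem existsUnique_comul (h : IsLeftD2 C) (α : bialgS C) :
    ∃! d : SS C, ∀ a a', evalPair C a a' d = α.1 (a * a') := by
  obtain ⟨q⟩ := exists_quasibases h
  refine ⟨_, q.evalPair_eq α, fun d hd => sub_eq_zero.1 (q.eq_zero _ fun a a' => ?_)⟩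
  rw [map_sub, hd, q.evalPair_eq, sub_self]

/-- The coproduct `Δ : S → S ⊗_V S` of the left `V`-bialgebroid `S = End _C A_C` of a depth two
extension: `Δ(α) = ∑ α₁ ⊗ α₂` is the unique element with `α(a a') = ∑ α₁(a) α₂(a')`. -/
noncomputable def comul (h : IsD2 C) (α : bialgS C) : SS C :=
  (existsUnique_comul h.1 α).choose

theorem evalPair_comul (h : IsD2 C) (α : bialgS C) (a a' : A) :
    evalPair C a a' (comul h α) = α.1 (a * a') :=
  (existsUnique_comul h.1 α).choose_spec.1 a a'

/-- The coproduct in terms of any left D2 quasibases: `Δ(α) = ∑_j α(- t_j¹) t_j² ⊗ β_j`. -/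
theorem comul_eq_sum (h : IsD2 C) (q : LeftQuasibases C) (α : bialgS C) :
    comul h α = ∑ j, btmul (centr C) (leg α (q.t j) (q.central j)) (q.β j) :=
  ((existsUnique_comul h.1 α).choose_spec.2 _ (q.evalPair_eq α)).symm

/-! ### Left coideal subrings -/

/-- A subring `J` of `S` with `V J ⊆ J`, as a left `V`-submodule of `S`. -/
def leftSubmodule (J : Subring (bialgS C)) (hJ : ∀ v : centr C, ∀ α ∈ J, v • α ∈ J) :
    Submodule (centr C) (bialgS C) where
  carrier := J
  add_mem' := J.add_mem
  zero_mem' := J.zero_mem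
  smul_mem' v _ hα := hJ v _ hα

/-- A left coideal subring of `S`: a subring `J`, stable under the left action of `V` (equivalently,
containing all left multiplications by elements of `V`), such that `Δ(J) ⊆ S ⊗_V J`. -/
structure IsLeftCoidealSubring (h : IsD2 C) (J : Subring (bialgS C)) : Prop where
  smul_mem : ∀ v : centr C, ∀ α ∈ J, v • α ∈ J
  comul_mem : ∀ α ∈ J,
    comul h α ∈ (BalTensor.lTensor (bialgS C) (leftSubmodule J smul_mem).subtype).range

/-- A Galois left coideal subring of `S`: a left coideal subring `J` which is finitely generated
projective as a left `V`-module and such that `0` and `A` are the only `J`-stable left ideals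
of `A`. -/
structure IsGaloisLeftCoidealSubring (h : IsD2 C) (J : Subring (bialgS C)) : Prop
    extends IsLeftCoidealSubring h J where
  finite : Module.Finite (centr C) (leftSubmodule J smul_mem)
  projective : Module.Projective (centr C) (leftSubmodule J smul_mem)
  simple : ∀ I : Ideal A, (∀ α ∈ J, ∀ x ∈ I, α.1 x ∈ I) → I = ⊥ ∨ I = ⊤

/-- The invariants `A^J = {x ∈ A | α(x) = α(1) x for all α ∈ J}`. -/
def invariants (J : Subring (bialgS C)) : Set A :=
  {x | ∀ α ∈ J, α.1 x = α.1 1 * x}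

/-- `B` is a left depth three intermediate division ring of `A ⊇ C`. -/
structure IsLeftD3IntermediateDivisionRing (C B : Subring A) : Prop where
  le : C ≤ B
  division : IsDivisionSubring B
  leftD3 : IsLeftD3 C B

end Towers

end DepthThree

namespace DepthThree

/-! ## Vector spaces over a ring all of whose nonzero elements are units -/

section VectorSpaces

variable {K : Type u} [Ring K] [Nontrivial K]
  {M : Type v} [AddCommGroup M] [Module K M]

/-! This is a Jacobson-Bourbaki correspondence, with both sides compared inside `End A`.

For a left D3 division ring `B`, the splitting amounts to quasibases `β_j ∈ End _C A_B`, `t_j ∈ (A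
⊗_B A)^C`. Contracting a right `B`-linear `f` with `x ⊗ 1 = ∑ t_j β_j(x)` gives `f = ∑ c_j β_j` with
`c_j ∈ A`, and `c_j ∈ V` if `f` is also left `C`-linear (`TowerQuasibases.expand_apply`,
`contrLin_mem_centr`). So `J = End _C A_B` is finitely generated projective over `V`, and `A J = End
A_B`. Multiplying by `a` on the left before contracting shows `Δ(J) ⊆ S ⊗_V J`. Over a division
ring, linear maps separate vectors from subspaces; this leaves no proper nonzero `J`-stable left
ideal and forces `A^J = B`.

Conversely, let `J` be Galois and `B = A^J`. The coideal condition writes `α(b -)` as an element of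
`A J`, so `A J` is a ring. `A` is a simple module over it whose endomorphisms are the right
multiplications by `B`, so `B` is a division ring by Schur. Left D2 makes `A` finite dimensional
over `C`, hence over `B`, and the density theorem gives `A J = End A_B`. Left D2 and flatness make
`A ⊗_V J → End A` injective. Faithfulness then descends `A ⊗_V J = A ⊗_V End _C A_B` to `J = End _C
A_B`, and a dual basis of `J` over `V`, transported through `A ⊗_V J ≅ End A_B`, yields left D3
quasibases. -/

theorem exists_linearMap_of_notMem (hK : ∀ x : K, x ≠ 0 → IsUnit x)
    {N : Type w} [AddCommGroup N] [Module K N]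
    (p : Submodule K M) {v : M} (hv : v ∉ p) (y : N) :
    ∃ g : M →ₗ[K] N, (∀ x ∈ p, g x = 0) ∧ g v = y := by
  let _ : DivisionRing K :=
    DivisionRing.ofIsUnitOrEqZero fun a => (em (a = 0)).symm.imp_left (hK a)
  obtain ⟨g, hg, hv⟩ := LinearMap.exists_extend_of_notMem (0 : p →ₗ[K] N) hv y
  exact ⟨g, fun x hx => by simpa using LinearMap.congr_fun hg ⟨x, hx⟩, hv⟩

theorem exists_basis_fin (hK : ∀ x : K, x ≠ 0 → IsUnit x) [Module.Finite K M] :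
    ∃ n : ℕ, Nonempty (Module.Basis (Fin n) K M) := by
  let _ : DivisionRing K :=
    DivisionRing.ofIsUnitOrEqZero fun a => (em (a = 0)).symm.imp_left (hK a)
  exact ⟨_, ⟨Module.finBasis K M⟩⟩

end VectorSpaces

/-! ### Contractions, the bimodule `A ⊗_B A`, and left D3 quasibases -/

section Towers

variable {A : Type u} [Ring A]

theorem IsDivisionSubring.nontrivial_op {B : Subring A} (hB : IsDivisionSubring B) :
    Nontrivial (↥B)ᵐᵒᵖ :=
  haveI := hB.1
  inferInstance

theorem IsDivisionSubring.isUnit_op {B : Subring A} (hB : IsDivisionSubring B) (x : (↥B)ᵐᵒᵖ)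
    (hx : x ≠ 0) : IsUnit x := by
  have := (hB.2 x.unop ((MulOpposite.unop_ne_zero_iff x).2 hx)).op
  simpa using this

theorem apply_mul_mem {B : Subring A} (f : A →ₗ[(↥B)ᵐᵒᵖ] A) (x : A) {b : A} (hb : b ∈ B) :
    f (x * b) = f x * b :=
  f.map_smul (MulOpposite.op (⟨b, hb⟩ : B)) x

/-- A right `B`-linear endomorphism of `A` from an additive endomorphism. -/
def rightLinear (B : Subring A) (f : AddMonoid.End A) (hf : ∀ b ∈ B, ∀ a, f (a * b) = f a * b) :
    A →ₗ[(↥B)ᵐᵒᵖ] A where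
  toFun := f
  map_add' := map_add f
  map_smul' b a := hf _ b.unop.2 a

/-- The map `A ⊗_B A → A`, `x ⊗ y ↦ f(x) y`, of a right `B`-linear endomorphism `f` of `A`. -/
def contrLin {B : Subring A} (f : A →ₗ[(↥B)ᵐᵒᵖ] A) : TensorSquare B →+ A :=
  BalTensor.lift
    (AddMonoidHom.mk' (fun x => AddMonoidHom.mk' (fun y => f x * y) fun y y' => mul_add _ _ _)
      fun x x' => by ext y; simp [add_mul])
    fun x b y => by
      change f (x * b) * y = f x * ((b : A) * y)
      rw [apply_mul_mem f x b.2, mul_assoc]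

@[simp] theorem contrLin_btmul {B : Subring A} (f : A →ₗ[(↥B)ᵐᵒᵖ] A) (x y : A) :
    contrLin f (btmul (↥B) x y) = f x * y := rfl

theorem contrLin_biAct_right {B : Subring A} (f : A →ₗ[(↥B)ᵐᵒᵖ] A) (y : A) (t : TensorSquare B) :
    contrLin f (biAct B 1 y t) = contrLin f t * y :=
  BalTensor.hom_ext (f := (contrLin f).comp (biAct B 1 y))
    (g := (AddMonoidHom.mulRight y).comp (contrLin f)) (by simp [mul_assoc]) t

theorem contrLin_biAct_left_of_comm {B : Subring A} (f : A →ₗ[(↥B)ᵐᵒᵖ] A) {c : A}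
    (hc : ∀ a, f (c * a) = c * f a) (t : TensorSquare B) :
    contrLin f (biAct B c 1 t) = c * contrLin f t :=
  BalTensor.hom_ext (f := (contrLin f).comp (biAct B c 1))
    (g := (AddMonoidHom.mulLeft c).comp (contrLin f)) (by simp [hc, mul_assoc]) t

theorem biAct_biAct (B : Subring A) (a a' b b' : A) (t : TensorSquare B) :
    biAct B a a' (biAct B b b' t) = biAct B (a * b) (b' * a') t :=
  BalTensor.hom_ext (f := (biAct B a a').comp (biAct B b b')) (g := biAct B (a * b) (b' * a'))
    (by simp [mul_assoc]) t

theorem biAct_add_right (B : Subring A) (a b b' : A) (t : TensorSquare B) :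
    biAct B a (b + b') t = biAct B a b t + biAct B a b' t :=
  BalTensor.hom_ext (f := biAct B a (b + b')) (g := biAct B a b + biAct B a b')
    (by simp [mul_add, btmul_add_right]) t

theorem biAct_zero_right (B : Subring A) (a : A) (t : TensorSquare B) : biAct B a 0 t = 0 := by
  simpa using biAct_add_right B a 0 0 t

theorem biAct_add_left (B : Subring A) (a a' b : A) (t : TensorSquare B) :
    biAct B (a + a') b t = biAct B a b t + biAct B a' b t :=
  BalTensor.hom_ext (f := biAct B (a + a') b) (g := biAct B a b + biAct B a' b)
    (by simp [add_mul, btmul_add_left]) t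

theorem btmul_mul_left (B : Subring A) (x y : A) {b : A} (hb : b ∈ B) :
    btmul (↥B) (x * b) y = btmul (↥B) x (b * y) :=
  btmul_smul (↥B) x ⟨b, hb⟩ y

/-- Left D3 quasibases of a tower `A ⊇ B ⊇ C`: elements `β_j ∈ End _C A_B` and
`t_j ∈ (A ⊗_B A)^C` with `x ⊗ y = ∑_j t_j β_j(x) y` for all `x, y ∈ A`. -/
structure TowerQuasibases (C B : Subring A) where
  n : ℕ
  β : Fin n → bimoduleEnd C B
  t : Fin n → TensorSquare B
  central : ∀ j, ∀ c ∈ C, biAct B c 1 (t j) = biAct B 1 c (t j)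
  eq : ∀ x y : A, btmul (↥B) x y = ∑ j, biAct B 1 ((β j).1 x * y) (t j)

/-- These are the coordinates of the splitting: `β_j(x)` is the `j`-th coordinate of `f(x ⊗ 1)` and
`t_j` is the image under `g` of the `j`-th standard vector. Moving `b ∈ B` across the tensor sign
makes `β_j` right `B`-linear. -/
theorem IsLeftD3.exists_quasibases {C B : Subring A} (h : IsLeftD3 C B) :
    Nonempty (TowerQuasibases C B) := by
  obtain ⟨n, f, g, hf, hg, hgf⟩ := h
  have hf1 : ∀ r : A, ∀ t i, f (biAct B 1 r t) i = f t i * r := fun r t i => by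
    rw [hf 1 C.one_mem r trivial, one_mul]
  refine ⟨⟨n, fun j => ⟨AddMonoidHom.mk' (fun x => f (btmul (↥B) x 1) j) ?_, ?_, ?_⟩,
    fun j => g (Pi.single j 1), ?_, ?_⟩⟩
  · intro x x'
    rw [btmul_add_left, map_add, Pi.add_apply]
  · intro c hc a
    change f (btmul (↥B) (c * a) 1) j = c * f (btmul (↥B) a 1) j
    simpa using hf c hc 1 trivial (btmul (↥B) a 1) j
  · intro b hb a
    have h1 := btmul_mul_left B a 1 hb
    have h2 := hf1 b (btmul (↥B) a 1) j
    rw [biAct_btmul, one_mul, one_mul] at h2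
    change f (btmul (↥B) (a * b) 1) j = f (btmul (↥B) a 1) j * b
    rw [← h2, h1, mul_one]
  · intro j c hc
    rw [← hg c hc 1 trivial, ← hg 1 C.one_mem c trivial]
    congr 1
    funext i
    by_cases hij : i = j
    · subst hij; simp
    · simp [Pi.single_eq_of_ne hij]
  · intro x y
    have h2 : f (btmul (↥B) x y) =
        ∑ j, fun i => (1 : A) * (Pi.single j (1 : A) : Fin n → A) i *
          (f (btmul (↥B) x 1) j * y) := by
      funext i
      rw [Finset.sum_apply, Finset.sum_eq_single i]
      · simpa using hf1 y (btmul (↥B) x 1) i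
      · intro j _ hj
        simp [Pi.single_eq_of_ne hj.symm]
      · simp
    rw [← hgf (btmul (↥B) x y), h2, map_sum]
    refine Finset.sum_congr rfl fun j _ => ?_
    rw [hg 1 C.one_mem _ trivial]
    rfl

/-- An element of `End _C A_B` as a right `B`-linear map. -/
def endToLin {C B : Subring A} (β : bimoduleEnd C B) : A →ₗ[(↥B)ᵐᵒᵖ] A :=
  rightLinear B β.1 β.2.2

@[simp] theorem endToLin_apply {C B : Subring A} (β : bimoduleEnd C B) (a : A) :
    endToLin β a = β.1 a := rfl

@[simp] theorem rightLinear_apply (B : Subring A) (f : AddMonoid.End A)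
    (hf : ∀ b ∈ B, ∀ a, f (a * b) = f a * b) (a : A) : rightLinear B f hf a = f a := rfl

/-- The splitting is rebuilt by contracting with the `β_j` and recombining with the `t_j`;
centrality of `t_j` is exactly left `C`-linearity of the recombination. -/
theorem TowerQuasibases.isLeftD3 {C B : Subring A} (q : TowerQuasibases C B) : IsLeftD3 C B := by
  refine ⟨q.n, AddMonoidHom.mk' (fun t j => contrLin (endToLin (q.β j)) t) ?_,
    AddMonoidHom.mk' (fun z => ∑ j, biAct B 1 (z j) (q.t j)) ?_, ?_, ?_, ?_⟩
  · intro s t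
    funext j
    exact map_add _ _ _
  · intro z z'
    simp [biAct_add_right, Finset.sum_add_distrib]
  · intro l hl r _ t j
    change contrLin (endToLin (q.β j)) (biAct B l r t) = l * contrLin (endToLin (q.β j)) t * r
    have h : biAct B l r t = biAct B 1 r (biAct B l 1 t) := by rw [biAct_biAct, one_mul, one_mul]
    rw [h, contrLin_biAct_right, contrLin_biAct_left_of_comm _ ((q.β j).2.1 l hl)]
  · intro l hl r _ z
    change ∑ j, biAct B 1 (l * z j * r) (q.t j) = biAct B l r (∑ j, biAct B 1 (z j) (q.t j))
    rw [map_sum]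
    refine Finset.sum_congr rfl fun j _ => ?_
    have h : biAct B l r (biAct B 1 (z j) (q.t j)) =
        biAct B 1 (z j * r) (biAct B l 1 (q.t j)) := by
      rw [biAct_biAct, biAct_biAct]; simp
    rw [h, q.central j l hl, biAct_biAct, mul_one, mul_assoc]
  · intro t
    change ∑ j, biAct B 1 (contrLin (endToLin (q.β j)) t) (q.t j) = t
    induction t using BalTensor.induction with
    | h0 => simp [biAct_zero_right]
    | hmul x y => exact (q.eq x y).symm
    | hadd s t hs ht =>
      simp only [map_add, biAct_add_right, Finset.sum_add_distrib]
      rw [hs, ht]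

/-- Multiply the quasibasis expansion of `x ⊗ 1` by `a` on the left and contract with `f`. For `f ∈
End _C A_B` this is the coproduct formula; `a = 1` gives the expansion of `f` in the `β_j`. -/
theorem TowerQuasibases.apply_eq {C B : Subring A} (q : TowerQuasibases C B)
    (f : A →ₗ[(↥B)ᵐᵒᵖ] A) (a x : A) :
    f (a * x) = ∑ j, contrLin f (biAct B a 1 (q.t j)) * (q.β j).1 x := by
  have h2 (j : Fin q.n) : contrLin f (biAct B a 1 (biAct B 1 ((q.β j).1 x * 1) (q.t j))) =
      contrLin f (biAct B a 1 (q.t j)) * (q.β j).1 x := by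
    rw [biAct_biAct, ← contrLin_biAct_right, biAct_biAct]; simp
  have h := congrArg (fun t => contrLin f (biAct B a 1 t)) (q.eq x 1)
  simp only [map_sum, h2] at h
  simpa using h

end Towers

/-! ### From left D3 division rings to Galois left coideal subrings -/

section Towers
variable {A : Type u} [Ring A]

theorem biAct_one_one (B : Subring A) (t : TensorSquare B) : biAct B 1 1 t = t :=
  BalTensor.hom_ext (f := biAct B 1 1) (g := AddMonoidHom.id _) (by simp) t

theorem TowerQuasibases.expand_apply {C B : Subring A} (q : TowerQuasibases C B)
    (f : A →ₗ[(↥B)ᵐᵒᵖ] A) (x : A) : f x = ∑ j, contrLin f (q.t j) * (q.β j).1 x := by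
  simpa [biAct_one_one] using q.apply_eq f 1 x

theorem contrLin_mem_centr {C B : Subring A} (f : A →ₗ[(↥B)ᵐᵒᵖ] A)
    (hf : ∀ c ∈ C, ∀ a, f (c * a) = c * f a) {t : TensorSquare B}
    (ht : ∀ c ∈ C, biAct B c 1 t = biAct B 1 c t) : contrLin f t ∈ centr C := by
  rw [Subring.mem_centralizer_iff]
  intro c hc
  rw [← contrLin_biAct_left_of_comm f (hf c hc), ht c hc, contrLin_biAct_right]

/-- The subring `End _C A_B` of `S = End _C A_C`. -/
def endSubring (C B : Subring A) : Subring (bialgS C) :=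
  (bimoduleEnd C B).comap (bialgS C).subtype

theorem mem_endSubring {C B : Subring A} {α : bialgS C} :
    α ∈ endSubring C B ↔ ∀ b ∈ B, ∀ a, α.1 (a * b) = α.1 a * b :=
  ⟨fun h => h.2, fun h => ⟨α.2.1, h⟩⟩

theorem endSubring_map {C B : Subring A} (h : C ≤ B) :
    (endSubring C B).map (bialgS C).subtype = bimoduleEnd C B := by
  ext f
  constructor
  · rintro ⟨α, hα, rfl⟩
    exact hα
  · intro hf
    exact ⟨⟨f, hf.1, fun c hc => hf.2 c (h hc)⟩, hf, rfl⟩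

theorem endSubring_anti (C : Subring A) {B B' : Subring A} (h : B ≤ B') :
    endSubring C B' ≤ endSubring C B := fun _ hα =>
  mem_endSubring.2 fun b hb => mem_endSubring.1 hα b (h hb)

theorem endSubring_smul_mem (C B : Subring A) (v : centr C) (α : bialgS C)
    (hα : α ∈ endSubring C B) : v • α ∈ endSubring C B :=
  mem_endSubring.2 fun b hb a => by
    rw [smul_val_apply, smul_val_apply, mem_endSubring.1 hα b hb, mul_assoc]

variable {C B : Subring A}

/-- An element of `endSubring C B` as a right `B`-linear map. -/
def endSubringToLin {α : bialgS C} (hα : α ∈ endSubring C B) : A →ₗ[(↥B)ᵐᵒᵖ] A :=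
  rightLinear B α.1 (mem_endSubring.1 hα)

@[simp] theorem endSubringToLin_apply {α : bialgS C} (hα : α ∈ endSubring C B) (a : A) :
    endSubringToLin hα a = α.1 a := rfl

namespace TowerQuasibases

/-- The elements `β_j` of left D3 quasibases as elements of `S`. -/
def toS (q : TowerQuasibases C B) (h : C ≤ B) (j : Fin q.n) : bialgS C :=
  ⟨(q.β j).1, (q.β j).2.1, fun c hc => (q.β j).2.2 c (h hc)⟩

theorem toS_mem (q : TowerQuasibases C B) (h : C ≤ B) (j : Fin q.n) :
    q.toS h j ∈ endSubring C B := (q.β j).2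

/-- The element `α(- t_j¹) t_j²` of `S` for `α ∈ End _C A_B`. -/
def leg (q : TowerQuasibases C B) {α : bialgS C} (hα : α ∈ endSubring C B)
    (j : Fin q.n) : bialgS C :=
  ⟨AddMonoidHom.mk' (fun a => contrLin (endSubringToLin hα) (biAct B a 1 (q.t j)))
    fun a a' => by rw [biAct_add_left, map_add], by
    refine ⟨fun c hc a => ?_, fun c hc a => ?_⟩
    · change contrLin (endSubringToLin hα) (biAct B (c * a) 1 (q.t j)) =
        c * contrLin (endSubringToLin hα) (biAct B a 1 (q.t j))
      rw [← contrLin_biAct_left_of_comm _ (α.2.1 c hc), biAct_biAct, mul_one]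
    · change contrLin (endSubringToLin hα) (biAct B (a * c) 1 (q.t j)) =
        contrLin (endSubringToLin hα) (biAct B a 1 (q.t j)) * c
      have h1 : biAct B (a * c) 1 (q.t j) = biAct B 1 c (biAct B a 1 (q.t j)) := by
        have h2 := congrArg (biAct B a 1) (q.central j c hc)
        rw [biAct_biAct, biAct_biAct] at h2
        simpa [biAct_biAct] using h2
      rw [h1, contrLin_biAct_right]⟩

/-- By uniqueness of the coproduct, `Δ(α) = ∑ α(- t_j¹) t_j² ⊗ β_j`, whose right legs lie in `End _C
A_B`. -/
theorem comul_mem (q : TowerQuasibases C B) (h : C ≤ B) (hD2 : IsD2 C) {α : bialgS C}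
    (hα : α ∈ endSubring C B) :
    comul hD2 α ∈ (BalTensor.lTensor (bialgS C)
      (leftSubmodule (endSubring C B) (endSubring_smul_mem C B)).subtype).range := by
  have h1 : comul hD2 α = ∑ j, btmul (centr C) (q.leg hα j) (q.toS h j) := by
    refine (existsUnique_comul hD2.1 α).unique (evalPair_comul hD2 α) fun a a' => ?_
    rw [map_sum]
    exact (q.apply_eq (endSubringToLin hα) a a').symm
  rw [h1]
  exact AddSubgroup.sum_mem _ fun j _ =>
    ⟨btmul (centr C) (q.leg hα j) ⟨q.toS h j, q.toS_mem h j⟩, rfl⟩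

/-- The coefficients `α ↦ (α(t_j¹) t_j²)_j`. -/
def coeffs (q : TowerQuasibases C B) :
    leftSubmodule (endSubring C B) (endSubring_smul_mem C B) →ₗ[centr C] Fin q.n → centr C where
  toFun α j := ⟨contrLin (endSubringToLin α.2) (q.t j),
    contrLin_mem_centr _ α.1.2.1 (q.central j)⟩
  map_add' α α' := by
    funext j
    refine Subtype.ext (BalTensor.hom_ext (f := contrLin (endSubringToLin (α + α').2))
      (g := contrLin (endSubringToLin α.2) + contrLin (endSubringToLin α'.2)) ?_ (q.t j))
    intro x y
    exact add_mul (α.1.1 x) (α'.1.1 x) y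
  map_smul' v α := by
    funext j
    refine Subtype.ext (BalTensor.hom_ext (f := contrLin (endSubringToLin (v • α).2))
      (g := (AddMonoidHom.mulLeft (v : A)).comp (contrLin (endSubringToLin α.2))) ?_ (q.t j))
    intro x y
    exact mul_assoc (v : A) (α.1.1 x) y

/-- The linear combinations of the `β_j` with coefficients in `V`. -/
noncomputable def combine (q : TowerQuasibases C B) (h : C ≤ B) : (Fin q.n → centr C) →ₗ[centr C]
    leftSubmodule (endSubring C B) (endSubring_smul_mem C B) :=
  ∑ j, (LinearMap.toSpanSingleton (centr C) _ ⟨q.toS h j, q.toS_mem h j⟩).comp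
    (LinearMap.proj j)

theorem combine_comp_coeffs (q : TowerQuasibases C B) (h : C ≤ B) :
    (q.combine h).comp q.coeffs = LinearMap.id := by
  ext α : 1
  refine Subtype.ext (bialgS_ext fun x => ?_)
  have h1 : ((q.combine h (q.coeffs α)).1 : bialgS C) = ∑ j, q.coeffs α j • q.toS h j := by
    simp [combine]
  change (q.combine h (q.coeffs α)).1.1 x = α.1.1 x
  rw [h1, sum_val_apply]
  exact (q.expand_apply (endSubringToLin α.2) x).symm

theorem finite (q : TowerQuasibases C B) (h : C ≤ B) : Module.Finite (centr C)
    (leftSubmodule (endSubring C B) (endSubring_smul_mem C B)) :=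
  Module.Finite.of_surjective (q.combine h) fun α =>
    ⟨q.coeffs α, LinearMap.congr_fun (q.combine_comp_coeffs h) α⟩

theorem projective (q : TowerQuasibases C B) (h : C ≤ B) : Module.Projective (centr C)
    (leftSubmodule (endSubring C B) (endSubring_smul_mem C B)) :=
  Module.Projective.of_split q.coeffs (q.combine h) (q.combine_comp_coeffs h)

/-- A right `B`-linear map carries a nonzero `x ∈ I` to `1`; it is an `A`-combination of the `β_j`,
which preserve `I`, so `1 ∈ I`. -/
theorem simple (q : TowerQuasibases C B) (h : C ≤ B) (hB : IsDivisionSubring B) (I : Ideal A)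
    (hI : ∀ α ∈ endSubring C B, ∀ x ∈ I, α.1 x ∈ I) : I = ⊥ ∨ I = ⊤ := by
  refine or_iff_not_imp_left.2 fun hne => (Ideal.eq_top_iff_one I).2 ?_
  obtain ⟨x, hx, hx0⟩ := Submodule.exists_mem_ne_zero_of_ne_bot hne
  have := hB.nontrivial_op
  obtain ⟨f, -, hf⟩ := exists_linearMap_of_notMem hB.isUnit_op
    (⊥ : Submodule (↥B)ᵐᵒᵖ A) (v := x) (by simpa using hx0) (1 : A)
  rw [← hf, q.expand_apply f x]
  exact I.sum_mem fun j _ => I.mul_mem_left _ (hI (q.toS h j) (q.toS_mem h j) x hx)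

/-- If `x ∉ B`, then `x` is outside the line `1·B`, so some right `B`-linear `f` has `f(1) = 0` and
`f(x) = 1`. But `f` is an `A`-combination of the `β_j`, so invariance of `x` forces `f(x) = f(1) x =
0`. -/
theorem invariants_eq (q : TowerQuasibases C B) (h : C ≤ B) (hB : IsDivisionSubring B) :
    invariants (endSubring C B) = B := by
  ext x
  constructor
  · intro hx
    by_contra hxB
    have := hB.nontrivial_op
    have hv : x ∉ Submodule.span (↥B)ᵐᵒᵖ {(1 : A)} := by
      rw [Submodule.mem_span_singleton]
      rintro ⟨b, rfl⟩
      refine hxB ?_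
      change (1 : A) * (b.unop : A) ∈ B
      simp
    obtain ⟨f, hf1, hf⟩ := exists_linearMap_of_notMem hB.isUnit_op _ hv (1 : A)
    have h1 : f x = f 1 * x := by
      rw [q.expand_apply f x, q.expand_apply f 1, Finset.sum_mul]
      refine Finset.sum_congr rfl fun j _ => ?_
      rw [mul_assoc]
      exact congrArg _ (hx (q.toS h j) (q.toS_mem h j))
    rw [hf, hf1 1 (Submodule.mem_span_singleton_self 1), zero_mul] at h1
    have := hB.1
    exact one_ne_zero (α := B) (Subtype.ext h1)
  · intro hx α hα
    simpa using mem_endSubring.1 hα x hx 1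

end TowerQuasibases

theorem IsLeftD3IntermediateDivisionRing.isGalois (hD2 : IsD2 C)
    (hB : IsLeftD3IntermediateDivisionRing C B) :
    IsGaloisLeftCoidealSubring hD2 (endSubring C B) := by
  obtain ⟨q⟩ := hB.leftD3.exists_quasibases
  exact
    { smul_mem := endSubring_smul_mem C B
      comul_mem := fun _ hα => q.comul_mem hB.le hD2 hα
      finite := q.finite hB.le
      projective := q.projective hB.le
      simple := q.simple hB.le hB.division }

end Towers

theorem BalTensor.lTensor_btmul {R : Type u} [Ring R] (M : Type v) [AddCommGroup M]
    [Module Rᵐᵒᵖ M] {N N' : Type*} [AddCommGroup N] [Module R N] [AddCommGroup N'] [Module R N']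
    (f : N →ₗ[R] N') (m : M) (n : N) :
    BalTensor.lTensor M f (btmul R m n) = btmul R m (f n) := rfl

/-! ### The embedding of `A ⊗_V S` in `End A` -/

section Towers
variable {A : Type u} [Ring A] {C : Subring A}

/-- The map `A ⊗_V S → End A`, `a ⊗ α ↦ a α(-)`. -/
def evalEnd (C : Subring A) : BalTensor (centr C) A (bialgS C) →+ AddMonoid.End A :=
  BalTensor.lift
    (AddMonoidHom.mk' (fun a => AddMonoidHom.mk' (fun α => (AddMonoidHom.mulLeft a).comp α.1)
        fun α β => AddMonoidHom.ext fun x => mul_add a (α.1 x) (β.1 x))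
      fun a b => AddMonoidHom.ext fun α => AddMonoidHom.ext fun x => add_mul a b (α.1 x))
    fun a v α => AddMonoidHom.ext fun x => mul_assoc a (v : A) (α.1 x)

@[simp] theorem evalEnd_btmul (a : A) (α : bialgS C) (x : A) :
    evalEnd C (btmul (centr C) a α) x = a * α.1 x := rfl

theorem add_end_apply (f g : AddMonoid.End A) (x : A) : (f + g) x = f x + g x := rfl

/-- The map `A ⊗_V S → A`, `a ⊗ α ↦ ∑ a α(t¹) t²`, of a tensor `t = ∑ t¹ ⊗ t²`. -/
def evalAt (t : TensorSquare C) : BalTensor (centr C) A (bialgS C) →+ A :=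
  BalTensor.lift
    (AddMonoidHom.mk' (fun a => AddMonoidHom.mk' (fun α => a * contr α 1 t)
        fun α β => by
          rw [← mul_add]
          congr 1
          exact BalTensor.hom_ext (f := contr (α + β) 1) (g := contr α 1 + contr β 1)
            (fun x y => add_mul _ _ _) t)
      fun a b => AddMonoidHom.ext fun α => add_mul a b _)
    fun a v α => by
      change a * v * contr α 1 t = a * contr (v • α) 1 t
      rw [mul_assoc]
      congr 1
      exact BalTensor.hom_ext (f := (AddMonoidHom.mulLeft (v : A)).comp (contr α 1))
        (g := contr (v • α) 1) (fun x y => (mul_assoc _ _ _).symm) t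

/-- At a pure tensor `x ⊗ y`, the value is the image of `d` in `End A` applied to `x`, times `y`; so
it depends only on that image. -/
theorem evalAt_eq_zero {d : BalTensor (centr C) A (bialgS C)} (hd : evalEnd C d = 0)
    (t : TensorSquare C) : evalAt t d = 0 := by
  induction t using BalTensor.induction with
  | h0 =>
    exact BalTensor.hom_ext (f := evalAt (0 : TensorSquare C)) (g := 0)
      (fun a α => by change a * contr α 1 0 = 0; simp) d
  | hmul x y =>
    have h : evalAt (btmul (↥C) x y) d = evalEnd C d x * y :=
      BalTensor.hom_ext (f := evalAt (btmul (↥C) x y)) (g := (AddMonoidHom.mulRight y).comp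
        ((AddMonoidHom.mk' (fun f : AddMonoid.End A => f x) fun _ _ => rfl).comp (evalEnd C)))
        (fun a α => by
          change a * (α.1 (1 * x) * y) = a * α.1 x * y
          rw [one_mul, mul_assoc]) d
    rw [h, hd]
    exact zero_mul y
  | hadd s t hs ht =>
    have h : evalAt (s + t) d = evalAt s d + evalAt t d :=
      BalTensor.hom_ext (f := evalAt (s + t)) (g := evalAt s + evalAt t)
        (fun a α => by
          change a * contr α 1 (s + t) = a * contr α 1 s + a * contr α 1 t
          rw [map_add, mul_add]) d
    rw [h, hs, ht, add_zero]

/-- Coordinates of `d` along the `β_j`. Since they are determined by the image of `d` in `End A`,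
injectivity of `evalEnd` follows. -/
theorem LeftQuasibases.eq_sum_evalAt (q : LeftQuasibases C)
    (d : BalTensor (centr C) A (bialgS C)) :
    d = ∑ j, btmul (centr C) (evalAt (q.t j) d) (q.β j) := by
  induction d using BalTensor.induction with
  | h0 => simp [btmul_zero_left]
  | hmul a α =>
    conv_lhs => rw [q.expand α]
    have h := map_sum (AddMonoidHom.mk' (fun β : bialgS C => btmul (centr C) a β)
      (btmul_add_right _ a)) (fun j => q.coeff α j • q.β j) Finset.univ
    refine h.trans (Finset.sum_congr rfl fun j _ => ?_)
    exact (btmul_smul (centr C) a (q.coeff α j) (q.β j)).symm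
  | hadd x y hx hy =>
    conv_lhs => rw [hx, hy]
    simp only [map_add, btmul_add_left, Finset.sum_add_distrib]

theorem evalEnd_injective (h : IsLeftD2 C) : Function.Injective (evalEnd C) := by
  obtain ⟨q⟩ := exists_quasibases h
  refine (injective_iff_map_eq_zero _).2 fun d hd => ?_
  rw [q.eq_sum_evalAt d]
  simp [evalAt_eq_zero hd, btmul_zero_left]

/-! ### The action of `A ⊗_V J` on `A` -/

section Act

variable {J : Subring (bialgS C)} (hJ : ∀ v : centr C, ∀ α ∈ J, v • α ∈ J)

/-- The tensor product `A ⊗_V J`. -/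
abbrev SmashTensor : Type u := BalTensor (centr C) A (leftSubmodule J hJ)

/-- The map `A ⊗_V J → End A`, `a ⊗ α ↦ a α(-)`. -/
def smashEnd : SmashTensor hJ →+ AddMonoid.End A :=
  (evalEnd C).comp (BalTensor.lTensor A (leftSubmodule J hJ).subtype)

@[simp] theorem smashEnd_btmul (a : A) (α : leftSubmodule J hJ) (x : A) :
    smashEnd hJ (btmul (centr C) a α) x = a * α.1.1 x := rfl

theorem smashEnd_add_apply (d d' : SmashTensor hJ) (x : A) :
    smashEnd hJ (d + d') x = smashEnd hJ d x + smashEnd hJ d' x := by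
  rw [map_add, add_end_apply]

/-- Flatness embeds `A ⊗_V J` in `A ⊗_V S`, which embeds in `End A` by left D2. -/
theorem smashEnd_injective (h : IsLeftD2 C) (hff : IsFaithfullyFlat (centr C) A) :
    Function.Injective (smashEnd hJ) :=
  (evalEnd_injective h).comp (hff.flat _ _ _ (Submodule.subtype_injective _))

theorem smashEnd_mul_right {b : A} (hb : ∀ α ∈ J, ∀ a, α.1 (a * b) = α.1 a * b)
    (d : SmashTensor hJ) (a : A) : smashEnd hJ d (a * b) = smashEnd hJ d a * b := by
  induction d using BalTensor.induction with
  | h0 => simp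
  | hmul a' α => simp [hb α.1 α.2, mul_assoc]
  | hadd d d' h h' => simp only [smashEnd_add_apply, h, h', add_mul]

theorem smashEnd_apply_of_mem_invariants {x : A} (hx : x ∈ invariants J) (d : SmashTensor hJ) :
    smashEnd hJ d x = smashEnd hJ d 1 * x := by
  induction d using BalTensor.induction with
  | h0 => simp
  | hmul a α => simp [hx α.1 α.2, mul_assoc]
  | hadd d d' h h' => simp only [smashEnd_add_apply, h, h', add_mul]

/-- The map `a ⊗ α ↦ x a y ⊗ α` of `A ⊗_V J`, for `y` in the double centralizer of `C`. -/
def smashMul (x y : A) (hy : ∀ v ∈ centr C, v * y = y * v) : SmashTensor hJ →+ SmashTensor hJ :=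
  BalTensor.lift
    (AddMonoidHom.mk' (fun a => AddMonoidHom.mk' (fun α => btmul (centr C) (x * a * y) α)
        fun α β => btmul_add_right _ _ _ _)
      fun a b => AddMonoidHom.ext fun α => by
        change btmul (centr C) (x * (a + b) * y) α = _
        rw [mul_add, add_mul, btmul_add_left]
        rfl)
    fun a v α => by
      change btmul (centr C) (x * (a * v) * y) α = btmul (centr C) (x * a * y) (v • α)
      rw [← btmul_smul, op_smul_eq]
      congr 1
      simp only [mul_assoc]
      rw [hy v v.2]

@[simp] theorem smashMul_btmul (x y : A) (hy : ∀ v ∈ centr C, v * y = y * v) (a : A)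
    (α : leftSubmodule J hJ) :
    smashMul hJ x y hy (btmul (centr C) a α) = btmul (centr C) (x * a * y) α := rfl

/-- The map `A ⊗_V J → A`, `a ⊗ α ↦ a φ(α)`, of a linear form `φ` on `J`. -/
def smashForm (φ : leftSubmodule J hJ →ₗ[centr C] centr C) : SmashTensor hJ →+ A :=
  BalTensor.lift
    (AddMonoidHom.mk' (fun a => AddMonoidHom.mk' (fun α => a * (φ α : A))
        fun α β => by simp [mul_add])
      fun a b => AddMonoidHom.ext fun α => add_mul a b _)
    fun a v α => by
      change a * v * (φ α : A) = a * (φ (v • α) : A)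
      simp [mul_assoc]

@[simp] theorem smashForm_btmul (φ : leftSubmodule J hJ →ₗ[centr C] centr C) (a : A)
    (α : leftSubmodule J hJ) : smashForm hJ φ (btmul (centr C) a α) = a * (φ α : A) := rfl

/-- The values of `φ` lie in `V`, so `y` moves past them. With `y ∈ C` this later makes the D3
quasibasis tensors central. -/
theorem smashForm_smashMul (φ : leftSubmodule J hJ →ₗ[centr C] centr C) (x y : A)
    (hy : ∀ v ∈ centr C, v * y = y * v) (d : SmashTensor hJ) :
    smashForm hJ φ (smashMul hJ x y hy d) = x * smashForm hJ φ d * y :=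
  BalTensor.hom_ext (f := (smashForm hJ φ).comp (smashMul hJ x y hy))
    (g := (AddMonoidHom.mulRight y).comp ((AddMonoidHom.mulLeft x).comp (smashForm hJ φ)))
    (fun a α => by simp [mul_assoc, hy _ (φ α).2]) d

theorem smashEnd_smashMul_left (x : A) (d : SmashTensor hJ) (z : A) :
    smashEnd hJ (smashMul hJ x 1 (by simp) d) z = x * smashEnd hJ d z := by
  induction d using BalTensor.induction with
  | h0 => simp
  | hmul a α => simp [mul_assoc]
  | hadd d d' h h' => rw [map_add, smashEnd_add_apply, smashEnd_add_apply, h, h', mul_add]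

theorem mul_comm_of_mem_centr {c : A} (hc : c ∈ C) : ∀ v ∈ centr C, v * c = c * v :=
  fun _ hv => (Subring.mem_centralizer_iff.1 hv c hc).symm

theorem smashEnd_smashMul_right {c : A} (hc : c ∈ C) (d : SmashTensor hJ) (z : A) :
    smashEnd hJ (smashMul hJ 1 c (mul_comm_of_mem_centr hc) d) z = smashEnd hJ d (c * z) := by
  induction d using BalTensor.induction with
  | h0 => simp
  | hmul a α => simp [mul_assoc, α.1.2.1 c hc]
  | hadd d d' h h' => rw [map_add, smashEnd_add_apply, smashEnd_add_apply, h, h']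

end Act

/-! ### The invariants of a Galois left coideal subring -/

section Coideal

variable {hD2 : IsD2 C} {J : Subring (bialgS C)}

/-- Here the coideal condition enters: `α(b x) = ∑ α₁(b) α₂(x)` with every `α₂` in `J`, so `α(b -)`
is the action of `∑ α₁(b) ⊗ α₂`. -/
theorem IsLeftCoidealSubring.exists_apply_mul (h : IsLeftCoidealSubring hD2 J) {α : bialgS C}
    (hα : α ∈ J) (b : A) :
    ∃ d : SmashTensor h.smul_mem, ∀ x, α.1 (b * x) = smashEnd h.smul_mem d x := by
  obtain ⟨e, he⟩ := h.comul_mem α hα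
  have key : ∀ e : BalTensor (centr C) (bialgS C) (leftSubmodule J h.smul_mem),
      ∃ d : SmashTensor h.smul_mem, ∀ x, evalPair C b x (BalTensor.lTensor (bialgS C)
        (leftSubmodule J h.smul_mem).subtype e) = smashEnd h.smul_mem d x := by
    intro e
    induction e using BalTensor.induction with
    | h0 => exact ⟨0, fun x => by simp⟩
    | hmul σ γ => exact ⟨btmul (centr C) (σ.1 b) γ, fun x => rfl⟩
    | hadd e e' h1 h2 =>
      obtain ⟨d, hd⟩ := h1
      obtain ⟨d', hd'⟩ := h2
      exact ⟨d + d', fun x => by rw [map_add, map_add, hd, hd', smashEnd_add_apply]⟩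
  obtain ⟨d, hd⟩ := key e
  exact ⟨d, fun x => by rw [← hd, he, evalPair_comul]⟩

theorem IsLeftCoidealSubring.apply_mul (h : IsLeftCoidealSubring hD2 J) {α : bialgS C}
    (hα : α ∈ J) (b : A) {x : A} (hx : x ∈ invariants J) : α.1 (b * x) = α.1 b * x := by
  obtain ⟨d, hd⟩ := h.exists_apply_mul hα b
  rw [hd, smashEnd_apply_of_mem_invariants _ hx, ← hd, mul_one]

/-- The subring of invariants of a left coideal subring. -/
def invariantsSubring (h : IsLeftCoidealSubring hD2 J) : Subring A where
  carrier := invariants J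
  mul_mem' {x y} hx hy α hα := by rw [h.apply_mul hα x hy, hx α hα, mul_assoc]
  one_mem' α _ := (mul_one _).symm
  add_mem' {x y} hx hy α hα := by rw [map_add, hx α hα, hy α hα, mul_add]
  zero_mem' α _ := by rw [map_zero, mul_zero]
  neg_mem' {x} hx α hα := by rw [map_neg, hx α hα, mul_neg]

theorem le_invariantsSubring (h : IsLeftCoidealSubring hD2 J) : C ≤ invariantsSubring h :=
  fun c hc α _ => by simpa using α.2.2 c hc 1

theorem le_endSubring (h : IsLeftCoidealSubring hD2 J) : J ≤ endSubring C (invariantsSubring h) :=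
  fun _ hα => mem_endSubring.2 fun _ hb a => h.apply_mul hα a hb

/-- The subring `A J` of `End A`, the image of the smash product `A ⊗_V J`. -/
def smashRing (h : IsLeftCoidealSubring hD2 J) : Subring (AddMonoid.End A) where
  __ := (smashEnd h.smul_mem).range
  one_mem' := ⟨btmul (centr C) 1 ⟨1, J.one_mem⟩, AddMonoidHom.ext fun x => one_mul x⟩
  mul_mem' := by
    have key₀ : ∀ (d : SmashTensor h.smul_mem) (a : A) (β : bialgS C), β ∈ J →
        ∃ d', ∀ x, smashEnd h.smul_mem d' x = a * smashEnd h.smul_mem d (β.1 x) := by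
      intro d a β hβ
      induction d using BalTensor.induction with
      | h0 => exact ⟨0, fun x => by simp⟩
      | hmul b α =>
        refine ⟨btmul (centr C) (a * b) ⟨α.1 * β, J.mul_mem α.2 hβ⟩, fun x => ?_⟩
        exact mul_assoc _ _ _
      | hadd d d' h1 h2 =>
        obtain ⟨e, he⟩ := h1
        obtain ⟨e', he'⟩ := h2
        exact ⟨e + e', fun x => by
          rw [smashEnd_add_apply, smashEnd_add_apply, he, he', mul_add]⟩
    have key : ∀ d d' : SmashTensor h.smul_mem, ∃ e, ∀ x,
        smashEnd h.smul_mem e x = smashEnd h.smul_mem d (smashEnd h.smul_mem d' x) := by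
      intro d d'
      induction d using BalTensor.induction with
      | h0 => exact ⟨0, fun x => by simp⟩
      | hmul a α =>
        induction d' using BalTensor.induction with
        | h0 => exact ⟨0, fun x => by simp⟩
        | hmul b β =>
          -- The smash product rule `(a α)(b β) = ∑ a α₁(b) α₂ β`.
          obtain ⟨e, he⟩ := h.exists_apply_mul α.2 b
          obtain ⟨e', he'⟩ := key₀ e a β.1 β.2
          exact ⟨e', fun x => by rw [he', smashEnd_btmul, smashEnd_btmul, he]⟩
        | hadd d d' h1 h2 =>
          obtain ⟨e, he⟩ := h1
          obtain ⟨e', he'⟩ := h2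
          exact ⟨e + e', fun x => by
            rw [smashEnd_add_apply, smashEnd_add_apply, he, he', map_add]⟩
      | hadd d d' h1 h2 =>
        obtain ⟨e, he⟩ := h1
        obtain ⟨e', he'⟩ := h2
        exact ⟨e + e', fun x => by rw [smashEnd_add_apply, smashEnd_add_apply, he, he']⟩
    rintro _ _ ⟨d, rfl⟩ ⟨d', rfl⟩
    obtain ⟨e, he⟩ := key d d'
    exact ⟨e, AddMonoidHom.ext he⟩

theorem mem_smashRing (h : IsLeftCoidealSubring hD2 J) {f : AddMonoid.End A} :
    f ∈ smashRing h ↔ ∃ d, smashEnd h.smul_mem d = f := Iff.rfl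

theorem smashRing_smul_def (h : IsLeftCoidealSubring hD2 J) (f : smashRing h) (x : A) :
    f • x = f.1 x := rfl

theorem mulLeft_mem_smashRing (h : IsLeftCoidealSubring hD2 J) (a : A) :
    AddMonoidHom.mulLeft a ∈ smashRing h :=
  ⟨btmul (centr C) a ⟨1, J.one_mem⟩, AddMonoidHom.ext fun _ => rfl⟩

theorem mem_smashRing_of_mem (h : IsLeftCoidealSubring hD2 J) {α : bialgS C} (hα : α ∈ J) :
    α.1 ∈ smashRing h :=
  ⟨btmul (centr C) 1 ⟨α, hα⟩, AddMonoidHom.ext fun x => one_mul (α.1 x)⟩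

/-- The ring `A J` contains all left multiplications and all of `J`, so its submodules of `A` are
`J`-stable left ideals. -/
theorem IsGaloisLeftCoidealSubring.isSimpleModule [Nontrivial A]
    (h : IsGaloisLeftCoidealSubring hD2 J) :
    IsSimpleModule (smashRing h.toIsLeftCoidealSubring) A := by
  refine (isSimpleModule_iff _ _).2 { eq_bot_or_eq_top := fun P => ?_ }
  let I : Ideal A :=
    { carrier := P
      add_mem' := P.add_mem
      zero_mem' := P.zero_mem
      smul_mem' := fun a x hx => P.smul_mem ⟨_, mulLeft_mem_smashRing h.toIsLeftCoidealSubring a⟩ hx }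
  have hI := h.simple I fun α hα x hx =>
    P.smul_mem ⟨_, mem_smashRing_of_mem h.toIsLeftCoidealSubring hα⟩ hx
  refine hI.imp (fun h0 => ?_) fun h1 => ?_
  · refine (Submodule.eq_bot_iff _).2 fun x hx => ?_
    have : x ∈ I := hx
    simpa [h0] using this
  · refine (Submodule.eq_top_iff').2 fun x => ?_
    have : x ∈ I := by rw [h1]; trivial
    exact this

/-- Right multiplication by an invariant as an endomorphism of the `A J`-module `A`. -/
def mulRightInvariant (h : IsLeftCoidealSubring hD2 J) (x : A) (hx : x ∈ invariants J) :
    Module.End (smashRing h) A where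
  toFun a := a * x
  map_add' a b := add_mul a b x
  map_smul' f a := by
    obtain ⟨d, hd⟩ := (mem_smashRing h).1 f.2
    rw [smashRing_smul_def, RingHom.id_apply, smashRing_smul_def, ← hd]
    exact (smashEnd_mul_right _ (fun α hα a => h.apply_mul hα a hx) d a).symm

theorem moduleEnd_apply (h : IsLeftCoidealSubring hD2 J) (φ : Module.End (smashRing h) A) (a : A) :
    φ a = a * φ 1 := by
  have h1 := φ.map_smul ⟨_, mulLeft_mem_smashRing h a⟩ 1
  change φ (a * 1) = a * φ 1 at h1
  rwa [mul_one] at h1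

/-- With `moduleEnd_apply`, this identifies the endomorphisms of the `A J`-module `A` with right
multiplications by invariants. -/
theorem moduleEnd_one_mem (h : IsLeftCoidealSubring hD2 J) (φ : Module.End (smashRing h) A) :
    φ 1 ∈ invariants J := fun α hα => by
  have h1 := φ.map_smul ⟨_, mem_smashRing_of_mem h hα⟩ 1
  rw [smashRing_smul_def, smashRing_smul_def, moduleEnd_apply] at h1
  exact h1.symm

/-- Schur's lemma for right multiplication by a nonzero invariant `x`: surjectivity gives a left
inverse `y`, and injectivity, which cancels `x` on the right, gives both `x y = 1` and the
invariance of `y`. -/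
theorem IsGaloisLeftCoidealSubring.isDivisionSubring [Nontrivial A]
    (h : IsGaloisLeftCoidealSubring hD2 J) :
    IsDivisionSubring (invariantsSubring h.toIsLeftCoidealSubring) := by
  have := h.isSimpleModule
  refine ⟨inferInstance, fun x hx => ?_⟩
  let φ := mulRightInvariant h.toIsLeftCoidealSubring x.1 x.2
  have hφ : Function.Bijective φ := by
    refine (LinearMap.bijective_or_eq_zero φ).resolve_right fun h0 => hx (Subtype.ext ?_)
    have h1 : φ 1 = 0 := by rw [h0]; rfl
    exact (one_mul x.1).symm.trans h1
  obtain ⟨y, hy⟩ := hφ.2 1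
  replace hy : y * x.1 = 1 := hy
  have hxy : x.1 * y = 1 := hφ.1 (by
    change x.1 * y * x.1 = 1 * x.1
    rw [mul_assoc, hy, mul_one, one_mul])
  have hyJ : y ∈ invariants J := fun α hα => hφ.1 (by
    change α.1 y * x.1 = α.1 1 * y * x.1
    rw [← h.apply_mul hα y x.2, mul_assoc, hy, mul_one])
  exact ⟨⟨x, ⟨y, hyJ⟩, Subtype.ext hxy, Subtype.ext hy⟩, rfl⟩

end Coideal

/-! ### Finite dimensionality -/

theorem exists_finset_contrLin_eq_zero {B : Subring A} (t : TensorSquare B) :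
    ∃ s : Set A, s.Finite ∧
      ∀ f : A →ₗ[(↥B)ᵐᵒᵖ] A, (∀ x ∈ s, f x = 0) → contrLin f t = 0 := by
  induction t using BalTensor.induction with
  | h0 => exact ⟨∅, Set.finite_empty, fun f _ => map_zero _⟩
  | hmul x y => exact ⟨{x}, Set.finite_singleton x, fun f hf => by simp [hf x rfl]⟩
  | hadd t t' h h' =>
    obtain ⟨s, hs, hst⟩ := h
    obtain ⟨s', hs', hst'⟩ := h'
    refine ⟨s ∪ s', hs.union hs', fun f hf => ?_⟩
    rw [map_add, hst f fun x hx => hf x (.inl hx), hst' f fun x hx => hf x (.inr hx), add_zero]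

/-- The finitely many left factors occurring in the `t_j` span `A`: a right `B`-linear map killing
them has all its coefficients zero, hence vanishes. -/
theorem TowerQuasibases.module_finite {B : Subring A} (q : TowerQuasibases C B)
    (hB : IsDivisionSubring B) : Module.Finite (↥B)ᵐᵒᵖ A := by
  choose s hs hst using fun j => exists_finset_contrLin_eq_zero (q.t j)
  refine ⟨Submodule.fg_def.2 ⟨⋃ j, s j, Set.finite_iUnion hs, Submodule.eq_top_iff'.2 ?_⟩⟩
  by_contra! ⟨v, hv⟩
  have := hB.nontrivial_op
  obtain ⟨f, hf, hfv⟩ := exists_linearMap_of_notMem hB.isUnit_op _ hv (1 : A)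
  have h0 : f v = 0 := by
    rw [q.expand_apply f v]
    refine Finset.sum_eq_zero fun j _ => ?_
    rw [hst j f fun x hx => hf x (Submodule.subset_span (Set.mem_iUnion_of_mem j hx)), zero_mul]
  have := hB.1
  exact one_ne_zero (α := B) (Subtype.ext (hfv.symm.trans h0))

theorem module_finite_of_le {B B' : Subring A} (h : B ≤ B') [Module.Finite (↥B)ᵐᵒᵖ A] :
    Module.Finite (↥B')ᵐᵒᵖ A := by
  obtain ⟨s, hs, hst⟩ := Submodule.fg_def.1 (Module.Finite.fg_top (R := (↥B)ᵐᵒᵖ) (M := A))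
  refine ⟨Submodule.fg_def.2 ⟨s, hs, Submodule.eq_top_iff'.2 fun x => ?_⟩⟩
  have hx : x ∈ Submodule.span (↥B)ᵐᵒᵖ s := hst ▸ Submodule.mem_top
  induction hx using Submodule.span_induction with
  | mem x hx => exact Submodule.subset_span hx
  | zero => exact Submodule.zero_mem _
  | add x y _ _ hx hy => exact Submodule.add_mem _ hx hy
  | smul b x _ hx =>
    exact Submodule.smul_mem _ (MulOpposite.op (⟨b.unop, h b.unop.2⟩ : B')) hx

/-! ### The Jacobson-Bourbaki argument -/

section Galois

variable {hD2 : IsD2 C} {J : Subring (bialgS C)}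

/-- By the Jacobson density theorem, `A ⊗_V J → End A_B` is onto, for `B` the invariants of `J`. -/
theorem IsGaloisLeftCoidealSubring.exists_smashEnd_eq [Nontrivial A]
    (h : IsGaloisLeftCoidealSubring hD2 J) (hC : IsDivisionSubring C)
    (f : A →ₗ[(↥(invariantsSubring h.toIsLeftCoidealSubring))ᵐᵒᵖ] A) :
    ∃ d, ∀ x, smashEnd h.smul_mem d x = f x := by
  have h' := h.toIsLeftCoidealSubring
  have := h.isSimpleModule
  -- Left D2 of `A ⊇ C` is left D3 of the tower `A ⊇ C ⊇ C`.
  obtain ⟨q⟩ := IsLeftD3.exists_quasibases (B := C) hD2.1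
  have := q.module_finite hC
  have := module_finite_of_le (le_invariantsSubring h')
  obtain ⟨s, hs⟩ :=
    Module.Finite.fg_top (R := (↥(invariantsSubring h'))ᵐᵒᵖ) (M := A)
  let f' : Module.End (Module.End (smashRing h') A) A :=
    { toFun := f
      map_add' := map_add f
      map_smul' := fun φ a => by
        change f (φ a) = φ (f a)
        rw [moduleEnd_apply h' φ a, moduleEnd_apply h' φ (f a)]
        exact apply_mul_mem f a (moduleEnd_one_mem h' φ) }
  -- Agreement on a finite spanning set suffices, since elements of `A J` are right `B`-linear too.
  obtain ⟨r, hr⟩ := jacobson_density f' s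
  obtain ⟨d, hd⟩ := (mem_smashRing h').1 r.2
  refine ⟨d, fun x => ?_⟩
  have hx : x ∈ Submodule.span (↥(invariantsSubring h'))ᵐᵒᵖ (s : Set A) :=
    hs ▸ Submodule.mem_top
  induction hx using Submodule.span_induction with
  | mem x hx =>
    rw [hd]
    exact (hr x hx).symm
  | zero => simp
  | add x y _ _ hx hy => rw [map_add, map_add, hx, hy]
  | smul b x _ hx =>
    rw [f.map_smul, ← hx]
    exact smashEnd_mul_right _ (fun α hα a => h'.apply_mul hα a b.unop.2) d x

/-- Both `A ⊗_V J` and `A ⊗_V End _C A_B` embed in `End A`, and by density the first already fills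
`End A_B`. Hence `A` tensored with the quotient of `End _C A_B` by `J` vanishes, and faithfulness
kills the quotient. -/
theorem IsGaloisLeftCoidealSubring.endSubring_invariants [Nontrivial A]
    (h : IsGaloisLeftCoidealSubring hD2 J) (hC : IsDivisionSubring C)
    (hff : IsFaithfullyFlat (centr C) A) :
    endSubring C (invariantsSubring h.toIsLeftCoidealSubring) = J := by
  have h' := h.toIsLeftCoidealSubring
  set B := invariantsSubring h.toIsLeftCoidealSubring
  refine le_antisymm (fun α hα => ?_) (le_endSubring h')
  let M := leftSubmodule (endSubring C B) (endSubring_smul_mem C B)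
  let ι : leftSubmodule J h.smul_mem →ₗ[centr C] M :=
    Submodule.inclusion (le_endSubring h')
  have hι : Function.Surjective (BalTensor.lTensor A ι) := by
    intro d
    have hd : ∀ b ∈ B, ∀ a, smashEnd (endSubring_smul_mem C B) d (a * b) =
        smashEnd (endSubring_smul_mem C B) d a * b := fun b hb a =>
      smashEnd_mul_right _ (fun β hβ => mem_endSubring.1 hβ b hb) d a
    obtain ⟨e, he⟩ := h.exists_smashEnd_eq hC (rightLinear B _ hd)
    refine ⟨e, smashEnd_injective (endSubring_smul_mem C B) hD2.1 hff
      (Eq.trans ?_ (AddMonoidHom.ext he))⟩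
    exact BalTensor.hom_ext
      (f := (smashEnd (endSubring_smul_mem C B)).comp (BalTensor.lTensor A ι))
      (g := smashEnd h.smul_mem) (fun a β => rfl) e
  let N : Submodule (centr C) M := LinearMap.range ι
  have h0 : ∀ d, BalTensor.lTensor A N.mkQ (BalTensor.lTensor A ι d) = 0 := fun d =>
    BalTensor.hom_ext (f := (BalTensor.lTensor A N.mkQ).comp (BalTensor.lTensor A ι))
      (g := 0) (fun a β => by
        have h1 : N.mkQ (ι β) = 0 := (Submodule.Quotient.mk_eq_zero N).2 ⟨β, rfl⟩
        change btmul (centr C) a (N.mkQ (ι β)) = 0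
        rw [h1, btmul_zero_right]) d
  have hsub : Subsingleton (BalTensor (centr C) A (M ⧸ N)) := by
    refine subsingleton_of_forall_eq 0 fun t => ?_
    induction t using BalTensor.induction with
    | h0 => rfl
    | hmul a m =>
      obtain ⟨m, rfl⟩ := N.mkQ_surjective m
      obtain ⟨d, hd⟩ := hι (btmul (centr C) a m)
      rw [← BalTensor.lTensor_btmul, ← hd, h0]
    | hadd x y hx hy => rw [hx, hy, add_zero]
  have hq := hff.faithful _ hsub
  have hmem : (⟨α, hα⟩ : M) ∈ N :=
    (Submodule.Quotient.mk_eq_zero N).1 (Subsingleton.elim _ _)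
  obtain ⟨β, hβ⟩ := hmem
  have h1 : β.1 = α := congrArg Subtype.val hβ
  exact h1 ▸ β.2

/-! ### Dual bases and the left D3 property of the invariants -/

theorem sum_end_apply {κ : Type*} (s : Finset κ) (f : κ → AddMonoid.End A) (x : A) :
    (∑ i ∈ s, f i) x = ∑ i ∈ s, f i x :=
  map_sum (AddMonoidHom.mk' (fun g : AddMonoid.End A => g x) fun _ _ => rfl) f s

theorem sum_btmul {R : Type u} [Ring R] {M : Type v} [AddCommGroup M] [Module Rᵐᵒᵖ M]
    {N : Type w} [AddCommGroup N] [Module R N] {κ : Type*} (s : Finset κ) (f : κ → M) (n : N) :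
    btmul R (∑ i ∈ s, f i) n = ∑ i ∈ s, btmul R (f i) n :=
  map_sum (AddMonoidHom.mk' (fun m => btmul R m n) fun m m' => btmul_add_left R m m' n) f s

/-- A finite dual basis of `A` as a right vector space over a division subring. -/
theorem IsDivisionSubring.exists_dualBasis {B : Subring A} (hB : IsDivisionSubring B)
    [Module.Finite (↥B)ᵐᵒᵖ A] : ∃ (n : ℕ) (e : Fin n → A) (p : Fin n → A →ₗ[(↥B)ᵐᵒᵖ] A),
      (∀ i x, p i x ∈ B) ∧ ∀ x, x = ∑ i, e i * p i x := by
  have := hB.nontrivial_op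
  obtain ⟨n, ⟨b⟩⟩ := exists_basis_fin hB.isUnit_op (M := A)
  refine ⟨n, b, fun i =>
    { toFun := fun x => ((b.coord i x).unop : A)
      map_add' := fun x y => by simp
      map_smul' := fun r x => by
        rw [map_smul]
        rfl }, fun i x => (b.coord i x).unop.2, fun x => ?_⟩
  exact (b.sum_repr x).symm

/-- Consequently contractions with right `B`-linear maps separate the elements of `A ⊗_B A`. -/
theorem eq_sum_contrLin {B : Subring A} {n : ℕ} {e : Fin n → A}
    {p : Fin n → A →ₗ[(↥B)ᵐᵒᵖ] A} (hpB : ∀ i x, p i x ∈ B) (hp : ∀ x, x = ∑ i, e i * p i x)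
    (t : TensorSquare B) : t = ∑ i, btmul (↥B) (e i) (contrLin (p i) t) := by
  induction t using BalTensor.induction with
  | h0 => simp [btmul_zero_right]
  | hmul x y =>
    conv_lhs => rw [hp x]
    rw [sum_btmul]
    exact Finset.sum_congr rfl fun i _ => btmul_mul_left B _ _ (hpB i x)
  | hadd s t hs ht =>
    conv_lhs => rw [hs, ht]
    simp only [map_add, btmul_add_right, Finset.sum_add_distrib]

/-- A dual basis `(β_j, φ_j)` of `J` over `V` induces left `A`-linear forms `Φ_j` on `A ⊗_V J ≅ End
A_B`. As `A` is finite dimensional over `B`, each such form is contraction with a tensor `t_j`, and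
`(β_j, t_j)` are left D3 quasibases. -/
theorem IsGaloisLeftCoidealSubring.isLeftD3 [Nontrivial A]
    (h : IsGaloisLeftCoidealSubring hD2 J) (hC : IsDivisionSubring C)
    (hff : IsFaithfullyFlat (centr C) A) :
    IsLeftD3 C (invariantsSubring h.toIsLeftCoidealSubring) := by
  have h' := h.toIsLeftCoidealSubring
  set B := invariantsSubring h.toIsLeftCoidealSubring
  have hB : IsDivisionSubring B := h.isDivisionSubring
  have hCB : C ≤ B := le_invariantsSubring h'
  obtain ⟨q⟩ := IsLeftD3.exists_quasibases (B := C) hD2.1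
  have := q.module_finite hC
  have := module_finite_of_le hCB
  have := h.finite
  have := h.projective
  obtain ⟨m, e, p, hpB, hp⟩ := hB.exists_dualBasis
  choose D hD using h.exists_smashEnd_eq hC
  have hext : ∀ s t : TensorSquare B, (∀ f, contrLin f s = contrLin f t) → s = t :=
    fun s t hst => by
      rw [eq_sum_contrLin hpB hp s, eq_sum_contrLin hpB hp t]
      simp only [hst]
  have hlin : ∀ d : SmashTensor h.smul_mem, ∀ b ∈ B, ∀ a,
      smashEnd h.smul_mem d (a * b) = smashEnd h.smul_mem d a * b := fun d b hb a =>
    smashEnd_mul_right _ (fun α hα a => h'.apply_mul hα a hb) d a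
  obtain ⟨n, F, G, -, -, hFG⟩ := Module.Finite.exists_comp_eq_id_of_projective (centr C)
    (leftSubmodule J h.smul_mem)
  let β : Fin n → leftSubmodule J h.smul_mem := fun j => F (Pi.single j 1)
  let φ : Fin n → leftSubmodule J h.smul_mem →ₗ[centr C] centr C :=
    fun j => (LinearMap.proj j).comp G
  have hβ : ∀ α, ∑ j, φ j α • β j = α := fun α => by
    have h1 : F (∑ j, G α j • Pi.single j 1) = F (G α) := by
      congr 1
      exact (pi_eq_sum_univ' (G α)).symm
    rw [map_sum] at h1
    simp only [map_smul] at h1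
    exact h1.trans (LinearMap.congr_fun hFG α)
  let Φ : Fin n → SmashTensor h.smul_mem →+ A := fun j => smashForm h.smul_mem (φ j)
  -- The only candidate: contraction of `p_i` with `t_j` must be `Φ_j` of the preimage `D (p i)`.
  let t : Fin n → TensorSquare B := fun j => ∑ i, btmul (↥B) (e i) (Φ j (D (p i)))
  -- In `End A_B` this says that `g = ∑ g(e_i) p_i(-)`; injectivity pulls it back to `A ⊗_V J`.
  have hdual : ∀ d : SmashTensor h.smul_mem,
      ∑ i, smashMul h.smul_mem (smashEnd h.smul_mem d (e i)) 1 (by simp) (D (p i)) = d := by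
    intro d
    refine smashEnd_injective h.smul_mem hD2.1 hff (AddMonoidHom.ext fun x => ?_)
    conv_rhs => rw [hp x]
    rw [map_sum]
    refine (sum_end_apply _ _ x).trans (Eq.trans ?_
      (map_sum (smashEnd h.smul_mem d) (fun i => e i * p i x) Finset.univ).symm)
    refine Finset.sum_congr rfl fun i _ => ?_
    rw [hlin d _ (hpB i x), ← hD]
    exact smashEnd_smashMul_left _ _ _ _
  have ht : ∀ (f : A →ₗ[(↥B)ᵐᵒᵖ] A) d, (∀ x, smashEnd h.smul_mem d x = f x) →
      ∀ j, contrLin f (t j) = Φ j d := by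
    intro f d hd j
    conv_rhs => rw [← hdual d]
    rw [map_sum, map_sum]
    refine Finset.sum_congr rfl fun i _ => ?_
    rw [contrLin_btmul, ← hd]
    exact ((smashForm_smashMul h.smul_mem (φ j) _ 1 _ _).trans (mul_one _)).symm
  refine TowerQuasibases.isLeftD3
    { n := n, t := t
      β := fun j => ⟨(β j).1.1, (le_endSubring h' (β j).2)⟩
      central := fun j c hc => hext _ _ fun f => ?_
      eq := fun x y => hext _ _ fun f => ?_ }
  -- Contracting `f` with `c t_j` is contracting `f(c -)` with `t_j`. Since `J` is left `C`-linear,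
  -- `f(c -)` comes from `D f` by `a ⊗ α ↦ a c ⊗ α`, and `Φ_j` turns this into right multiplication
  -- by `c`.
  · let fc : A →ₗ[(↥B)ᵐᵒᵖ] A := rightLinear B (f.toAddMonoidHom.comp (AddMonoidHom.mulLeft c))
      fun b hb a => by
        change f (c * (a * b)) = f (c * a) * b
        rw [← mul_assoc, apply_mul_mem f _ hb]
    have h1 : contrLin f (biAct B c 1 (t j)) = contrLin fc (t j) :=
      BalTensor.hom_ext (f := (contrLin f).comp (biAct B c 1)) (g := contrLin fc)
        (fun x y => by
          change f (c * x) * (y * 1) = f (c * x) * y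
          rw [mul_one]) (t j)
    rw [h1, contrLin_biAct_right, ht f (D f) (hD f) j,
      ht fc (smashMul h.smul_mem 1 c (mul_comm_of_mem_centr hc) (D f))
        (fun x => by rw [smashEnd_smashMul_right _ hc, hD]; rfl) j]
    exact (smashForm_smashMul h.smul_mem (φ j) 1 c _ _).trans (by rw [one_mul])
  -- The dual basis identity of `J`, extended to `A ⊗_V J` and evaluated at `x`.
  · have h1 : ∀ d : SmashTensor h.smul_mem,
        smashEnd h.smul_mem d x = ∑ j, Φ j d * (β j).1.1 x := by
      intro d
      induction d using BalTensor.induction with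
      | h0 => simp
      | hmul a α =>
        rw [smashEnd_btmul]
        conv_lhs => rw [← hβ α]
        have h2 : ((∑ j, φ j α • β j : leftSubmodule J h.smul_mem) : bialgS C) =
            ∑ j, φ j α • (β j).1 := by simp
        rw [h2, sum_val_apply, Finset.mul_sum]
        exact Finset.sum_congr rfl fun j _ => (mul_assoc a _ _).symm
      | hadd d d' h h' =>
        rw [smashEnd_add_apply, h, h']
        simp only [map_add, add_mul, Finset.sum_add_distrib]
    rw [contrLin_btmul, ← hD f, h1, map_sum, Finset.sum_mul]
    refine Finset.sum_congr rfl fun j _ => ?_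
    rw [contrLin_biAct_right, ht f (D f) (hD f) j, mul_assoc]

theorem IsGaloisLeftCoidealSubring.isLeftD3IntermediateDivisionRing [Nontrivial A]
    (h : IsGaloisLeftCoidealSubring hD2 J) (hC : IsDivisionSubring C)
    (hff : IsFaithfullyFlat (centr C) A) :
    IsLeftD3IntermediateDivisionRing C (invariantsSubring h.toIsLeftCoidealSubring) :=
  ⟨le_invariantsSubring _, h.isDivisionSubring, h.isLeftD3 hC hff⟩

theorem invariants_anti {J J' : Subring (bialgS C)} (h : J ≤ J') : invariants J' ⊆ invariants J :=
  fun _ hx α hα => hx α (h hα)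

theorem IsLeftD3IntermediateDivisionRing.invariants_endSubring {B : Subring A}
    (hB : IsLeftD3IntermediateDivisionRing C B) : invariants (endSubring C B) = B := by
  obtain ⟨q⟩ := hB.leftD3.exists_quasibases
  exact q.invariants_eq hB.le hB.division

end Galois

end Towers

end DepthThree

/-! ### The Galois correspondence -/

open DepthThree in
theorem theorem6p3 {A : Type u} [Ring A] {D : Type v} [DivisionRing D] (ε : A →+* D)
    (C : Subring A) (hC : IsDivisionSubring C) (hD2 : IsD2 C)
    (hff : IsFaithfullyFlat (centr C) A) :
    ∃ e : {B : Subring A // IsLeftD3IntermediateDivisionRing C B} ≃o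
        {J : Subring (bialgS C) // IsGaloisLeftCoidealSubring hD2 J}ᵒᵈ,
      (∀ B, (OrderDual.ofDual (e B)).1.map (bialgS C).subtype = bimoduleEnd C B.1) ∧
      ∀ J, ((e.symm (OrderDual.toDual J)).1 : Set A) = invariants J.1 := by
  -- The augmentation supplies `A ≠ 0`, which simplicity of `A` over `A J` requires.
  have : Nontrivial A := ε.domain_nontrivial
  let e : {B : Subring A // IsLeftD3IntermediateDivisionRing C B} ≃o
      {J : Subring (bialgS C) // IsGaloisLeftCoidealSubring hD2 J}ᵒᵈ :=
    { toFun := fun B => OrderDual.toDual ⟨endSubring C B.1, B.2.isGalois hD2⟩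
      invFun := fun J => ⟨invariantsSubring (OrderDual.ofDual J).2.toIsLeftCoidealSubring,
        (OrderDual.ofDual J).2.isLeftD3IntermediateDivisionRing hC hff⟩
      left_inv := fun B => Subtype.ext (SetLike.coe_injective B.2.invariants_endSubring)
      right_inv := fun J => Subtype.ext ((OrderDual.ofDual J).2.endSubring_invariants hC hff)
      map_rel_iff' := fun {B B'} => by
        -- Inclusions are reflected by taking invariants, which reverses them and recovers `B` and
        -- `B'`.
        refine ⟨fun h => ?_, fun h => endSubring_anti C h⟩
        have h1 : invariants (endSubring C B.1) ⊆ invariants (endSubring C B'.1) :=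
          invariants_anti h
        rw [B.2.invariants_endSubring, B'.2.invariants_endSubring] at h1
        exact h1 }
  exact ⟨e, fun B => endSubring_map B.2.le, fun J => rfl⟩
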